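/- For integers $0<k<d$ put $S_k=\sqrt{\dfrac{d}{\pi k(d-k)}}$, and fix real numbers $v_0,v_1\ge 0$. Then there is a constant $C$, depending only on $v_0$ and $v_1$, such that the following holds for every integer $d\ge 2$. Let $b_0,\dots,b_d$ be independent real normal random variables with mean $0$, where $b_k$ has variance $1/S_k=1\big/\sqrt{\frac{d}{\pi k(d-k)}}$ for $0<k<d$, $b_0$ has variance $v_0$ and $b_d$ has variance $v_1$ (a normal variable of variance $0$ being the constant $0$). Consider the random polynomial in the Bernstein basis $$\widehat P(z)=\sum_{k=0}^{d} b_k\binom dk z^k(1-z)^{d-k}.$$ Then $\widehat P$ is almost surely not the zero polynomial, the number $N$ of its distinct real roots is an integrable random variable, and $$\bigl|\,\mathbb E[N]-\sqrt{2d}\,\bigr|\le C,$$ that is, the expected number of real roots of $\widehat P$ is $\sqrt{2d}\pm O(1)$ as $d\to\infty$. -/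

import Mathlib

open MeasureTheory ProbabilityTheory
open scoped NNReal

noncomputable section

/-- The quantity `S_k = √(d / (π k (d - k)))`, meaningful for `0 < k < d`. -/
def stirlingFactor (d k : ℕ) : ℝ :=
  √((d : ℝ) / (Real.pi * (k : ℝ) * ((d : ℝ) - (k : ℝ))))

/-- The variance of the `k`-th coefficient: `1 / S_k` for `0 < k < d`. The formula has no value
at `k = 0` and `k = d`; the variances of the two end coefficients are the parameters
`v₀` and `v₁`. -/
def coeffVariance (v₀ v₁ : ℝ≥0) (d k : ℕ) : ℝ≥0 :=
  if k = 0 then v₀ else if k = d then v₁ else Real.toNNReal (1 / stirlingFactor d k)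

/-- The polynomial `∑ₖ bₖ (d choose k) z ^ k (1 - z) ^ (d - k)`. -/
def bernsteinSum (d : ℕ) (b : Fin (d + 1) → ℝ) : Polynomial ℝ :=
  ∑ k : Fin (d + 1), Polynomial.C (b k) * bernsteinPolynomial ℝ d (k : ℕ)

/-- The number of distinct real roots of a nonzero real polynomial
(the value at the zero polynomial is `0`). -/
def numRealRoots (p : Polynomial ℝ) : ℕ := p.roots.toFinset.card

end

/-! In the coordinate t = z/(1 - z) the polynomial becomes ∑ bₖ (d choose k) tᵏ up to a nonvanishing
factor. The four charts (z : 1 - z) = (±t : 1), (1 : ±t) with 0 < t < 1 reach every real z except 0,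
1/2 and 1. Changing t to -t preserves the law of the coefficients, and reversing their order only
swaps v₀ and v₁. So it suffices to show that the expected number of zeros in (0, 1) is √(2d)/4 +
O(1) (`exists_lintegral_unitIntervalZeros`); four such contributions give √(2d).

Kac–Rice (`lintegral_count_zeros_gaussian`) writes this expectation as the integral of √V(t) / (π
t), where V(t) is the variance of k under weights proportional to wₖ t²ᵏ, wₖ being the variance of
the coefficient of tᵏ. The weights satisfy an exact two-term recurrence X(k+1) wₖ₊₁ = Y(d-k) wₖ, in
which X(j) and Y(j) are (j - 1/4)² + O(1), also at the two ends
(`recurrenceCoeff_mul_monomialVariance`, `abs_recurrenceCoeff_sub_le`).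

Summation by parts then produces a Stein identity for these weights. Two test functions give the
first two moments of the linear statistic q = (k - 1/4) - t (d + 3/4 - k), and hence V = td / (2 (1
+ t)²) + O(1), uniformly in d and t (`exists_abs_variance_sub_le`). For small td this is too weak,
and the constant test function supplies V = O((td)²) (`exists_variance_le_mul_sq`).

Together these bounds put √V within O(√s / (1 + s)), s = td, of √(s/2) / (1 + t). Against dt / (π t)
the main term integrates to exactly √(2d)/4, and the error integrates to O(1) because √s / (1 + s)
is integrable for ds/s on (0, ∞). -/

/-! ### Area formula and measurability of zero counts -/

open Set in
/-- A function which is strictly differentiable with nonzero derivative on a measurable set is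
injective on each piece of a countable measurable partition. -/
theorem exists_partition_injOn {g : ℝ → ℝ} {U : Set ℝ} (hU : MeasurableSet U)
    (hg : ∀ x ∈ U, HasStrictDerivAt g (deriv g x) x) (h0 : ∀ x ∈ U, deriv g x ≠ 0) :
    ∃ A : ℕ → Set ℝ, (∀ n, MeasurableSet (A n)) ∧ Pairwise (Function.onFun Disjoint A) ∧
      (⋃ n, A n) = U ∧ ∀ n, InjOn g (A n) := by
  have key : ∀ x ∈ U, ∃ V : Set ℝ, IsOpen V ∧ x ∈ V ∧ InjOn g V := by
    intro x hx
    have h1 := ((hg x hx).hasStrictFDerivAt_equiv (h0 x hx))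
    refine ⟨(h1.toOpenPartialHomeomorph g).source, (h1.toOpenPartialHomeomorph g).open_source,
      h1.mem_toOpenPartialHomeomorph_source, ?_⟩
    simpa using (h1.toOpenPartialHomeomorph g).injOn
  choose! V hVo hVx hVi using key
  -- Lindelöf: countably many of the neighbourhoods given by the inverse function theorem cover U.
  obtain ⟨t, htU, htc, hUt⟩ := TopologicalSpace.countable_cover_nhdsWithin (s := U) (f := V)
    fun x hx => mem_nhdsWithin_of_mem_nhds ((hVo x hx).mem_nhds (hVx x hx))
  rcases t.eq_empty_or_nonempty with rfl | hne
  · have hUe : U = ∅ := by simpa [subset_empty_iff] using hUt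
    exact ⟨fun _ => ∅, fun _ => .empty, fun _ _ _ => by simp [Function.onFun], by simp [hUe],
      fun _ => by simp⟩
  obtain ⟨e, he⟩ := htc.exists_eq_range hne
  have het : ∀ n, e n ∈ U := fun n => htU (he ▸ mem_range_self n)
  refine ⟨fun n => disjointed (fun m => V (e m) ∩ U) n, fun n => ?_, disjoint_disjointed _, ?_, ?_⟩
  · exact MeasurableSet.disjointed (fun m => ((hVo _ (het m)).measurableSet.inter hU)) n
  · rw [iUnion_disjointed]
    apply subset_antisymm
    · exact iUnion_subset fun n => inter_subset_right
    · intro x hx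
      have := hUt hx
      simp only [mem_iUnion, he, mem_range, exists_prop, exists_exists_eq_and] at this
      obtain ⟨n, hn⟩ := this
      exact mem_iUnion.2 ⟨n, hn, hx⟩
  · exact fun n => (hVi _ (het n)).mono ((disjointed_subset _ n).trans inter_subset_left)

open Set in
/-- The one-dimensional area formula. -/
theorem lintegral_mul_count_fiber {g : ℝ → ℝ} {U : Set ℝ} (hU : MeasurableSet U)
    (hg : ∀ x ∈ U, HasStrictDerivAt g (deriv g x) x) {h : ℝ → ENNReal} (hh : Measurable h) :
    ∫⁻ y, h y * Measure.count (U ∩ g ⁻¹' {y}) =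
      ∫⁻ x in U, ENNReal.ofReal |deriv g x| * h (g x) := by
  set W := U ∩ {x | deriv g x ≠ 0} with hW
  set Z := U ∩ {x | deriv g x = 0} with hZ
  have hWm : MeasurableSet W :=
    hU.inter (measurable_deriv g (measurableSet_singleton (0 : ℝ)).compl)
  have hZm : MeasurableSet Z := hU.inter (measurable_deriv g (measurableSet_singleton (0 : ℝ)))
  have hUWZ : U = W ∪ Z := by
    ext x; simp only [hW, hZ, mem_union, mem_inter_iff, mem_ofPred_eq]; tauto
  -- One-dimensional Sard: critical values form a null set, so critical points contribute to neither
  -- side.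
  have hZ0 : volume (g '' Z) = 0 := by
    refine addHaar_image_eq_zero_of_det_fderivWithin_eq_zero volume (s := Z)
      (f' := fun x => ContinuousLinearMap.toSpanSingleton ℝ (deriv g x))
      (fun x hx => ((hg x hx.1).hasDerivAt.hasFDerivAt).hasFDerivWithinAt) fun x hx => ?_
    simp [show deriv g x = 0 from hx.2]
  obtain ⟨A, hAm, hAd, hAU, hAi⟩ := exists_partition_injOn hWm (fun x hx => hg x hx.1)
    (fun x hx => hx.2)
  have hder : ∀ n, ∀ x ∈ A n, HasDerivWithinAt g (deriv g x) (A n) x := fun n x hx =>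
    (hg x (by have := mem_iUnion_of_mem n hx; rw [hAU] at this; exact this.1)).hasDerivAt.hasDerivWithinAt
  have hgm : ∀ n, MeasurableSet (g '' A n) := fun n =>
    measurable_image_of_fderivWithin (hAm n) (fun x hx => (hder n x hx).hasFDerivWithinAt) (hAi n)
  have hsub : ∀ n y, (A n ∩ g ⁻¹' {y}).Subsingleton := by
    rintro n y a ⟨ha, hya⟩ b ⟨hb, hyb⟩
    exact hAi n ha hb (hya.trans hyb.symm)
  have hcount : ∀ y, y ∉ g '' Z → Measure.count (U ∩ g ⁻¹' {y}) =
      ∑' n, (g '' A n).indicator 1 y := by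
    intro y hy
    have h1 : U ∩ g ⁻¹' {y} = ⋃ n, (A n ∩ g ⁻¹' {y}) := by
      rw [← iUnion_inter, hAU]
      ext x
      simp only [mem_inter_iff, mem_preimage, mem_singleton_iff, hUWZ, mem_union]
      constructor
      · rintro ⟨h1 | h1, h2⟩
        · exact ⟨h1, h2⟩
        · exact absurd ⟨x, h1, h2⟩ hy
      · rintro ⟨h1, h2⟩; exact ⟨Or.inl h1, h2⟩
    rw [h1, measure_iUnion]
    · refine tsum_congr fun n => ?_
      by_cases hyn : y ∈ g '' A n
      · obtain ⟨x, hx, rfl⟩ := hyn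
        have : A n ∩ g ⁻¹' {g x} = {x} :=
          (hsub n (g x)).eq_singleton_of_mem ⟨hx, rfl⟩
        rw [this, Measure.count_singleton, indicator_of_mem (mem_image_of_mem g hx)]; rfl
      · have : A n ∩ g ⁻¹' {y} = ∅ := by
          ext x; simp only [mem_inter_iff, mem_preimage, mem_singleton_iff, mem_empty_iff_false,
            iff_false, not_and]
          exact fun hx hxy => hyn ⟨x, hx, hxy⟩
        rw [this, measure_empty, indicator_of_notMem hyn]
    · exact fun i j hij => (hAd hij).mono inter_subset_left inter_subset_left
    · exact fun n => (hsub n y).measurableSet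
  have hZint : ∫⁻ x in Z, ENNReal.ofReal |deriv g x| * h (g x) = 0 := by
    rw [setLIntegral_congr_fun hZm (g := fun _ => 0) (fun x hx => by
      simp [show deriv g x = 0 from hx.2])]
    simp
  have hdisj : Disjoint W Z := by
    rw [Set.disjoint_left]; exact fun x hx hx' => hx.2 hx'.2
  calc ∫⁻ y, h y * Measure.count (U ∩ g ⁻¹' {y})
      = ∫⁻ y, ∑' n, (g '' A n).indicator h y := by
        refine lintegral_congr_ae ?_
        filter_upwards [measure_eq_zero_iff_ae_notMem.1 hZ0] with y hy
        rw [hcount y hy, ← ENNReal.tsum_mul_left]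
        refine tsum_congr fun n => ?_
        by_cases hyn : y ∈ g '' A n <;> simp [hyn]
    _ = ∑' n, ∫⁻ y, (g '' A n).indicator h y :=
        lintegral_tsum fun n => (hh.indicator (hgm n)).aemeasurable
    _ = ∑' n, ∫⁻ x in A n, ENNReal.ofReal |deriv g x| * h (g x) := by
        refine tsum_congr fun n => ?_
        rw [lintegral_indicator (hgm n),
          lintegral_image_eq_lintegral_abs_deriv_mul (hAm n) (hder n) (hAi n)]
    _ = ∫⁻ x in W, ENNReal.ofReal |deriv g x| * h (g x) := by
        rw [← hAU, lintegral_iUnion hAm hAd]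
    _ = ∫⁻ x in U, ENNReal.ofReal |deriv g x| * h (g x) := by
        conv_rhs => rw [hUWZ, lintegral_union hZm hdisj, hZint, add_zero]

open Set in
/-- The number of points of the sections of a closed relation is measurable. -/
theorem measurable_count_section {E : Type*} [TopologicalSpace E] [MeasurableSpace E]
    [BorelSpace E] {Z : Set (E × ℝ)} (hZ : IsClosed Z) {U : Set ℝ} (hU : IsOpen U) :
    Measurable fun x => Measure.count (U ∩ {t | (x, t) ∈ Z}) := by
  -- Projection along a compact factor is a closed map.
  have hcpt : ∀ K : Set ℝ, IsCompact K → MeasurableSet {x | ∃ t ∈ K, (x, t) ∈ Z} := by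
    intro K hK
    have : CompactSpace K := isCompact_iff_compactSpace.1 hK
    have : {x | ∃ t ∈ K, (x, t) ∈ Z} =
        Prod.fst '' ((fun p : E × K => (p.1, (p.2 : ℝ))) ⁻¹' Z) := by
      ext x; simp
    rw [this]
    exact (isClosedMap_fst_of_compactSpace _ (hZ.preimage (by fun_prop))).measurableSet
  -- Half-open cells tile the line without overlap. Writing U and `Iio b` as countable unions of
  -- closed sets turns each cell into a countable union of compact sets.
  have hint : ∀ a b : ℝ, MeasurableSet {x | ∃ t ∈ U ∩ Ico a b, (x, t) ∈ Z} := by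
    intro a b
    obtain ⟨F, hF, -, hFU, -⟩ := hU.exists_iUnion_isClosed
    obtain ⟨G, hG, -, hGU, -⟩ := (isOpen_Iio (a := b)).exists_iUnion_isClosed
    have : {x | ∃ t ∈ U ∩ Ico a b, (x, t) ∈ Z} =
        ⋃ m, ⋃ l, {x | ∃ t ∈ F m ∩ G l ∩ Icc a b, (x, t) ∈ Z} := by
      ext x
      simp only [← hFU, mem_ofPred_eq, mem_iUnion]
      constructor
      · rintro ⟨t, ⟨htU, ht⟩, hx⟩
        obtain ⟨m, hm⟩ := mem_iUnion.1 htU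
        obtain ⟨l, hl⟩ := mem_iUnion.1 (hGU ▸ ht.2 : t ∈ ⋃ n, G n)
        exact ⟨m, l, t, ⟨⟨hm, hl⟩, ht.1, ht.2.le⟩, hx⟩
      · rintro ⟨m, l, t, ⟨⟨hm, hl⟩, ht⟩, hx⟩
        exact ⟨t, ⟨mem_iUnion_of_mem m hm, ht.1, (hGU ▸ mem_iUnion_of_mem l hl : t ∈ Iio b)⟩, hx⟩
    rw [this]
    exact .iUnion fun m => .iUnion fun l =>
      hcpt _ (isCompact_Icc.inter_left ((hF m).inter (hG l)))
  have hcell : ∀ (n : ℕ) (j : ℤ) (t : ℝ), ⌊(n + 1) * t⌋ = j ↔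
      t ∈ Ico ((j : ℝ) / (n + 1)) ((j + 1) / (n + 1)) := by
    intro n j t
    have hn : (0 : ℝ) < n + 1 := by positivity
    rw [Int.floor_eq_iff, mem_Ico, div_le_iff₀ hn, lt_div_iff₀ hn, mul_comm]
  have hcells : ∀ (n : ℕ), Measurable fun x =>
      Measure.count ((fun t : ℝ => ⌊((n : ℝ) + 1) * t⌋) '' (U ∩ {t | (x, t) ∈ Z})) := by
    intro n
    have : (fun x => Measure.count ((fun t : ℝ => ⌊((n : ℝ) + 1) * t⌋) '' (U ∩ {t | (x, t) ∈ Z})))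
        = fun x => ∑' j : ℤ, {x | ∃ t ∈ U ∩ Ico ((j : ℝ) / (n + 1)) ((j + 1) / (n + 1)),
          (x, t) ∈ Z}.indicator (1 : E → ENNReal) x := by
      funext x
      rw [Measure.count, Measure.sum_apply _ (by measurability)]
      refine tsum_congr fun j => ?_
      rw [Measure.dirac_apply' _ (by measurability)]
      have hiff : j ∈ (fun t : ℝ => ⌊((n : ℝ) + 1) * t⌋) '' (U ∩ {t | (x, t) ∈ Z}) ↔
          x ∈ {x | ∃ t ∈ U ∩ Ico ((j : ℝ) / (n + 1)) ((j + 1) / (n + 1)), (x, t) ∈ Z} := by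
        constructor
        · rintro ⟨t, ⟨h1, h2⟩, h3⟩; exact ⟨t, ⟨h1, (hcell n j t).1 h3⟩, h2⟩
        · rintro ⟨t, ⟨h1, h3⟩, h2⟩; exact ⟨t, ⟨h1, h2⟩, (hcell n j t).2 h3⟩
      by_cases hx : x ∈ {x | ∃ t ∈ U ∩ Ico ((j : ℝ) / (n + 1)) ((j + 1) / (n + 1)), (x, t) ∈ Z}
      · rw [indicator_of_mem hx, indicator_of_mem (hiff.2 hx)]; rfl
      · rw [indicator_of_notMem hx, indicator_of_notMem fun h => hx (hiff.1 h)]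
    rw [this]
    exact Measurable.tsum fun j => measurable_one.indicator (hint _ _)
  -- The number of occupied cells never exceeds the number of points, and a fine enough mesh
  -- separates any given finite subset of S.
  have hsup : ∀ S : Set ℝ, Measure.count S =
      ⨆ n : ℕ, Measure.count ((fun t : ℝ => ⌊((n : ℝ) + 1) * t⌋) '' S) := by
    intro S
    have hfin : ∀ F : Finset ℝ, (F : Set ℝ) ⊆ S → (F.card : ENNReal) ≤
        ⨆ n : ℕ, Measure.count ((fun t : ℝ => ⌊((n : ℝ) + 1) * t⌋) '' S) := by
      intro F hF
      have hn : ∀ᶠ n : ℕ in Filter.atTop, ∀ p ∈ F.offDiag, 1 ≤ ((n : ℝ) + 1) * |p.1 - p.2| := by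
        refine (Finset.eventually_all F.offDiag).2 fun p hp => ?_
        have hpos : 0 < |p.1 - p.2| := abs_pos.2 (sub_ne_zero.2 (Finset.mem_offDiag.1 hp).2.2)
        exact ((Filter.tendsto_atTop_add_const_right _ _
          tendsto_natCast_atTop_atTop).atTop_mul_const hpos).eventually_ge_atTop 1
      obtain ⟨n, hn⟩ := hn.exists
      have hinj : InjOn (fun t : ℝ => ⌊((n : ℝ) + 1) * t⌋) F := by
        intro a ha b hb hab
        by_contra hne
        have h1 := hn (a, b) (Finset.mem_offDiag.2 ⟨ha, hb, hne⟩)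
        have h2 := Int.abs_sub_lt_one_of_floor_eq_floor hab
        rw [← mul_sub, abs_mul, abs_of_nonneg (by positivity)] at h2
        exact absurd h2 (not_lt.2 h1)
      refine le_iSup_of_le n ?_
      calc (F.card : ENNReal) = Measure.count ((F.image fun t : ℝ => ⌊((n : ℝ) + 1) * t⌋ :
            Finset ℤ) : Set ℤ) := by
            rw [Measure.count_apply_finset, Finset.card_image_of_injOn hinj]
        _ ≤ _ := measure_mono (by rw [Finset.coe_image]; exact image_mono hF)
    apply le_antisymm
    · by_cases hS : S.Finite
      · rw [Measure.count_apply_finite S hS]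
        exact hfin _ (by simp)
      · rw [Measure.count_apply_infinite hS, top_le_iff]
        refine ENNReal.eq_top_of_forall_nnreal_le fun r => ?_
        obtain ⟨F, hF, hc⟩ := Set.Infinite.exists_subset_card_eq hS ⌈r⌉₊
        refine le_trans ?_ (hfin F hF)
        rw [hc]
        exact_mod_cast Nat.le_ceil r
    · refine iSup_le fun n => ?_
      by_cases hS : S.Finite
      · rw [Measure.count_apply_finite S hS, Measure.count_apply_finite _ (hS.image _)]
        have : (hS.image fun t : ℝ => ⌊((n : ℝ) + 1) * t⌋).toFinset =
            hS.toFinset.image fun t : ℝ => ⌊((n : ℝ) + 1) * t⌋ := by ext; simp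
        rw [this]
        exact_mod_cast Finset.card_image_le
      · rw [Measure.count_apply_infinite hS]; exact le_top
  simp_rw [hsup]
  exact Measurable.iSup hcells

/-! ### Gaussian integrals and linear forms -/

theorem integral_abs_gaussianReal (s : ℝ≥0) :
    ∫ x, |x| ∂(gaussianReal 0 s) = √(2 * s / Real.pi) := by
  rcases eq_or_ne s 0 with rfl | hs
  · simp [gaussianReal_zero_var]
  have hs' : (0 : ℝ) < s := by exact_mod_cast pos_iff_ne_zero.2 hs
  rw [integral_gaussianReal_eq_integral_smul hs]
  have h1 : ∀ x : ℝ, gaussianPDFReal 0 s x • |x| =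
      (fun y : ℝ => (√(2 * Real.pi * s))⁻¹ * (y ^ (1 : ℝ) *
        Real.exp (-(1 / (2 * s)) * y ^ (2 : ℝ)))) |x| := by
    intro x
    have : |x| ^ (2 : ℝ) = x ^ 2 := by
      rw [show (2 : ℝ) = ((2 : ℕ) : ℝ) by norm_num, Real.rpow_natCast, sq_abs]
    simp only [gaussianPDFReal, sub_zero, smul_eq_mul, Real.rpow_one, this]
    rw [show -(1 / (2 * (s : ℝ))) * x ^ 2 = -x ^ 2 / (2 * s) by ring]
    ring
  simp_rw [h1]
  rw [integral_comp_abs (f := fun y : ℝ => (√(2 * Real.pi * s))⁻¹ * (y ^ (1 : ℝ) *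
        Real.exp (-(1 / (2 * s)) * y ^ (2 : ℝ)))), integral_const_mul,
    integral_rpow_mul_exp_neg_mul_rpow (by norm_num) (by norm_num) (by positivity)]
  rw [show -((1 : ℝ) + 1) / 2 = -1 by norm_num, show ((1 : ℝ) + 1) / 2 = 1 by norm_num,
    Real.Gamma_one, Real.rpow_neg_one]
  symm
  rw [Real.sqrt_eq_iff_mul_self_eq (by positivity) (by positivity)]
  have hsq : √(2 * Real.pi * s) * √(2 * Real.pi * s) = 2 * Real.pi * s :=
    Real.mul_self_sqrt (by positivity)
  have hpi := Real.pi_pos.ne'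
  set q := √(2 * Real.pi * s)
  have hne : q ≠ 0 := by positivity
  field_simp
  rw [pow_two, hsq]
  ring

theorem lintegral_abs_gaussianReal (s : ℝ≥0) :
    ∫⁻ x, ENNReal.ofReal |x| ∂(gaussianReal 0 s) = ENNReal.ofReal √(2 * s / Real.pi) := by
  rw [← integral_abs_gaussianReal, ofReal_integral_eq_lintegral_ofReal]
  · exact ((memLp_id_gaussianReal' 1 (by simp)).integrable le_rfl).abs
  · exact .of_forall fun x => abs_nonneg x

/-- Multiplying a centred Gaussian law by a centred Gaussian density. -/
theorem lintegral_mul_gaussianPDF_gaussianReal {w : ℝ≥0} (hw : w ≠ 0) (α : ℝ≥0) {f : ℝ → ENNReal}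
    (hf : Measurable f) :
    ∫⁻ x, f x * gaussianPDF 0 w (-x) ∂(gaussianReal 0 α) =
      gaussianPDF 0 (w + α) 0 * ∫⁻ x, f x ∂(gaussianReal 0 (w * α / (w + α))) := by
  rcases eq_or_ne α 0 with rfl | hα
  · simp [gaussianReal_zero_var, mul_comm, lintegral_dirac' 0 hf]
  have hs : w * α / (w + α) ≠ 0 := by positivity
  have hw' : (0 : ℝ) < w := by exact_mod_cast pos_iff_ne_zero.2 hw
  have hα' : (0 : ℝ) < α := by exact_mod_cast pos_iff_ne_zero.2 hα
  rw [gaussianReal_of_var_ne_zero _ hα, gaussianReal_of_var_ne_zero _ hs,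
    lintegral_withDensity_eq_lintegral_mul _ (measurable_gaussianPDF _ _) (by fun_prop),
    lintegral_withDensity_eq_lintegral_mul _ (measurable_gaussianPDF _ _) hf,
    ← lintegral_const_mul _ (by fun_prop)]
  refine lintegral_congr fun x => ?_
  simp only [Pi.mul_apply]
  have key : gaussianPDFReal 0 α x * gaussianPDFReal 0 w (-x) =
      gaussianPDFReal 0 (w + α) 0 * gaussianPDFReal 0 (w * α / (w + α)) x := by
    simp only [gaussianPDFReal, NNReal.coe_add, NNReal.coe_mul, NNReal.coe_div, sub_zero]
    rw [mul_mul_mul_comm, mul_mul_mul_comm _ (Real.exp (-0 ^ 2 / (2 * (w + α : ℝ)))),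
      ← Real.exp_add, ← Real.exp_add, ← mul_inv, ← mul_inv, ← Real.sqrt_mul (by positivity),
      ← Real.sqrt_mul (by positivity)]
    congr 1
    · congr 2
      field_simp
    · congr 1
      field_simp
      ring
  have : gaussianPDF 0 α x * gaussianPDF 0 w (-x) =
      gaussianPDF 0 (w + α) 0 * gaussianPDF 0 (w * α / (w + α)) x := by
    simp only [gaussianPDF]
    rw [← ENNReal.ofReal_mul (gaussianPDFReal_nonneg _ _ _), key,
      ENNReal.ofReal_mul (gaussianPDFReal_nonneg _ _ _)]
  rw [mul_left_comm, this, mul_left_comm, mul_comm (f x)]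

theorem lintegral_abs_mul_add_gaussianReal (r : ℝ) (s u : ℝ≥0) :
    ∫⁻ p : ℝ × ℝ, ENNReal.ofReal |r * p.1 + p.2| ∂((gaussianReal 0 s).prod (gaussianReal 0 u)) =
      ENNReal.ofReal √(2 * (r ^ 2 * s + u) / Real.pi) := by
  have h1 : (gaussianReal 0 s).map (fun x => r * x) = gaussianReal 0 (NNReal.mk (r ^ 2) (sq_nonneg r) * s) := by
    simpa using gaussianReal_map_const_mul (μ := 0) (v := s) r
  have h2 : ((gaussianReal 0 s).prod (gaussianReal 0 u)).map (fun p : ℝ × ℝ => r * p.1 + p.2) =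
      gaussianReal 0 (NNReal.mk (r ^ 2) (sq_nonneg r) * s + u) := by
    have h3 := gaussianReal_conv_gaussianReal (m₁ := 0) (m₂ := 0)
      (v₁ := NNReal.mk (r ^ 2) (sq_nonneg r) * s) (v₂ := u)
    rw [add_zero] at h3
    rw [← h3, ← h1, Measure.conv]
    have h4 : ((gaussianReal 0 s).map (fun x => r * x)).prod (gaussianReal 0 u) =
        ((gaussianReal 0 s).prod (gaussianReal 0 u)).map (Prod.map (fun x => r * x) id) := by
      rw [← Measure.map_prod_map _ _ (by fun_prop) measurable_id, Measure.map_id]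
    rw [h4, Measure.map_map (by fun_prop) (by fun_prop)]
    rfl
  have h5 := lintegral_abs_gaussianReal (NNReal.mk (r ^ 2) (sq_nonneg r) * s + u)
  rw [← h2, lintegral_map (by fun_prop) (by fun_prop)] at h5
  rw [h5]
  rfl

section LinearForms

variable {ι : Type*} [Fintype ι] (v : ι → ℝ≥0)

theorem hasGaussianLaw_pi_gaussianReal :
    HasGaussianLaw (fun x : ι → ℝ => x) (Measure.pi fun k => gaussianReal 0 (v k)) := by
  refine iIndepFun.hasGaussianLaw (X := fun k (x : ι → ℝ) => x k) (fun k => ?_)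
    (iIndepFun_pi (X := fun _ => id) fun _ => aemeasurable_id)
  have : (Measure.pi fun k => gaussianReal 0 (v k)).map (fun x : ι → ℝ => x k) =
      gaussianReal 0 (v k) := (measurePreserving_eval _ k).map_eq
  exact ⟨by rw [this]; infer_instance⟩

theorem covariance_linear_pi_gaussianReal (a c : ι → ℝ) :
    cov[fun x : ι → ℝ => ∑ k, a k * x k, fun x => ∑ k, c k * x k;
      Measure.pi fun k => gaussianReal 0 (v k)] = ∑ k, v k * a k * c k := by
  classical
  have hX := hasGaussianLaw_pi_gaussianReal v
  have hL : ∀ k, MemLp (fun x : ι → ℝ => x k) 2 (Measure.pi fun k => gaussianReal 0 (v k)) :=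
    fun k => (hX.eval k).memLp_two
  have hcov : ∀ i j, cov[fun x : ι → ℝ => x i, fun x => x j;
      Measure.pi fun k => gaussianReal 0 (v k)] = if i = j then (v i : ℝ) else 0 := by
    intro i j
    split_ifs with h
    · subst h
      rw [covariance_self (Measurable.aemeasurable (by fun_prop))]
      have h1 := (measurePreserving_eval (fun k => gaussianReal 0 (v k)) i)
      have h2 := variance_id_gaussianReal (μ := 0) (v := v i)
      rw [← h1.map_eq, variance_map (by fun_prop) h1.measurable.aemeasurable] at h2
      exact h2
    · exact ((iIndepFun_pi (μ := fun k => gaussianReal 0 (v k)) (X := fun _ => id)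
        fun _ => aemeasurable_id).indepFun h).covariance_eq_zero (hL i) (hL j)
  rw [covariance_fun_sum_fun_sum (fun i => (hL i).const_mul _) (fun i => (hL i).const_mul _)]
  simp only [covariance_const_mul_left, covariance_const_mul_right, hcov]
  simp only [mul_ite, mul_zero, Finset.sum_ite_eq, Finset.mem_univ, if_true]
  exact Finset.sum_congr rfl fun k _ => by ring

theorem map_linear_pi_gaussianReal (a : ι → ℝ) :
    (Measure.pi fun k => gaussianReal 0 (v k)).map (fun x : ι → ℝ => ∑ k, a k * x k) =
      gaussianReal 0 (∑ k, v k * a k * a k).toNNReal := by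
  have hX := hasGaussianLaw_pi_gaussianReal v
  have hG : HasGaussianLaw (fun x : ι → ℝ => ∑ k, a k * x k)
      (Measure.pi fun k => gaussianReal 0 (v k)) := by
    have := hX.map_fun (∑ k, a k • ContinuousLinearMap.proj (R := ℝ) (φ := fun _ : ι => ℝ) k)
    simpa using this
  rw [hG.map_eq_gaussianReal, ← covariance_self (Measurable.aemeasurable (by fun_prop)),
    covariance_linear_pi_gaussianReal]
  congr 1
  rw [integral_finsetSum _ fun k _ => ((hX.eval k).integrable.const_mul _)]
  refine Finset.sum_eq_zero fun k _ => ?_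
  rw [integral_const_mul]
  have h1 := (measurePreserving_eval (fun k => gaussianReal 0 (v k)) k)
  have h2 := integral_id_gaussianReal (μ := 0) (v := v k)
  rw [← h1.map_eq, integral_map h1.measurable.aemeasurable (by fun_prop)] at h2
  simp only [Function.eval] at h2
  rw [h2, mul_zero]

/-- The Gaussian expectation in the Kac–Rice formula. -/
theorem lintegral_abs_mul_gaussianPDF {w : ℝ≥0} (hw : w ≠ 0) (a c : ι → ℝ) {α β γ : ℝ}
    (hα : α = ∑ k, v k * a k * a k) (hβ : β = ∑ k, v k * a k * c k)
    (hγ : γ = ∑ k, v k * c k * c k) :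
    ∫⁻ x : ι → ℝ, ENNReal.ofReal |∑ k, c k * x k| * gaussianPDF 0 w (-∑ k, a k * x k)
        ∂(Measure.pi fun k => gaussianReal 0 (v k)) =
      ENNReal.ofReal (√((w + α) * γ - β ^ 2) / (Real.pi * (w + α))) := by
  set P := Measure.pi fun k => gaussianReal 0 (v k)
  have hX := hasGaussianLaw_pi_gaussianReal v
  have hw' : (0 : ℝ) < w := by exact_mod_cast pos_iff_ne_zero.2 hw
  have hterm : ∀ k, 0 ≤ (v k : ℝ) * a k * a k := fun k => by
    rw [mul_assoc]; exact mul_nonneg (v k).2 (mul_self_nonneg _)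
  have hα0 : 0 ≤ α := hα ▸ Finset.sum_nonneg fun k _ => hterm k
  -- r is the regression coefficient of the form c on the form a. If α = 0, then v k = 0 or a k = 0
  -- for each k, so β = 0 as well and any r works.
  obtain ⟨r, hr⟩ : ∃ r, r * α = β := by
    rcases eq_or_ne α 0 with h | h
    · refine ⟨0, ?_⟩
      rw [zero_mul, hβ]
      symm
      refine Finset.sum_eq_zero fun k _ => ?_
      have h1 := (Finset.sum_eq_zero_iff_of_nonneg fun k _ => hterm k).1 (hα.symm.trans h) k
        (Finset.mem_univ k)
      rcases mul_eq_zero.1 h1 with h2 | h2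
      · rw [h2, zero_mul]
      · rw [h2, mul_zero, zero_mul]
    · exact ⟨β / α, by field_simp⟩
  have he : ∀ x : ι → ℝ, ∑ k, c k * x k = r * (∑ k, a k * x k) + ∑ k, (c k - r * a k) * x k := by
    intro x
    rw [Finset.mul_sum, ← Finset.sum_add_distrib]
    exact Finset.sum_congr rfl fun k _ => by ring
  have hu : ∑ k, (v k : ℝ) * (c k - r * a k) * (c k - r * a k) = γ - r * β := by
    have : ∑ k, (v k : ℝ) * (c k - r * a k) * (c k - r * a k) = γ - 2 * r * β + r ^ 2 * α := by
      rw [hα, hβ, hγ, Finset.mul_sum, Finset.mul_sum, ← Finset.sum_sub_distrib,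
        ← Finset.sum_add_distrib]
      exact Finset.sum_congr rfl fun k _ => by ring
    rw [this, ← hr]; ring
  have hu0 : 0 ≤ γ - r * β := hu ▸ Finset.sum_nonneg fun k _ => by
    rw [mul_assoc]; exact mul_nonneg (v k).2 (mul_self_nonneg _)
  -- The residual of the regression is uncorrelated with the form a; joint Gaussianity upgrades this
  -- to independence.
  have hind : IndepFun (fun x : ι → ℝ => ∑ k, a k * x k)
      (fun x : ι → ℝ => ∑ k, (c k - r * a k) * x k) P := by
    refine HasGaussianLaw.indepFun_of_covariance_eq_zero ?_ ?_
    · have := hX.map_fun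
        ((∑ k, a k • ContinuousLinearMap.proj (R := ℝ) (φ := fun _ : ι => ℝ) k).prod
        (∑ k, (c k - r * a k) • ContinuousLinearMap.proj (R := ℝ) (φ := fun _ : ι => ℝ) k))
      simpa using this
    · rw [covariance_linear_pi_gaussianReal]
      have : ∑ k, (v k : ℝ) * a k * (c k - r * a k) = β - r * α := by
        rw [hα, hβ, Finset.mul_sum, ← Finset.sum_sub_distrib]
        exact Finset.sum_congr rfl fun k _ => by ring
      rw [this, hr, sub_self]
  have hlaw := (indepFun_iff_map_prod_eq_prod_map_map (Measurable.aemeasurable (by fun_prop))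
    (Measurable.aemeasurable (by fun_prop))).1 hind
  rw [map_linear_pi_gaussianReal, map_linear_pi_gaussianReal, hu, ← hα] at hlaw
  set A : ℝ≥0 := α.toNNReal with hA
  set B : ℝ≥0 := (γ - r * β).toNNReal with hB
  have hAc : (A : ℝ) = α := Real.coe_toNNReal _ hα0
  have hBc : (B : ℝ) = γ - r * β := Real.coe_toNNReal _ hu0
  calc ∫⁻ x : ι → ℝ, ENNReal.ofReal |∑ k, c k * x k| * gaussianPDF 0 w (-∑ k, a k * x k) ∂P
      = ∫⁻ p : ℝ × ℝ, ENNReal.ofReal |r * p.1 + p.2| * gaussianPDF 0 w (-p.1)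
          ∂((gaussianReal 0 A).prod (gaussianReal 0 B)) := by
        rw [← hlaw, lintegral_map (by fun_prop) (by fun_prop)]
        simp_rw [he]
    _ = ∫⁻ x, (∫⁻ y, ENNReal.ofReal |r * x + y| ∂(gaussianReal 0 B)) * gaussianPDF 0 w (-x)
          ∂(gaussianReal 0 A) := by
        rw [lintegral_prod _ (by fun_prop)]
        refine lintegral_congr fun x => ?_
        have hm : Measurable fun y : ℝ => ENNReal.ofReal |r * x + y| := by fun_prop
        exact lintegral_mul_const (gaussianPDF 0 w (-x)) hm
    _ = gaussianPDF 0 (w + A) 0 * ∫⁻ p : ℝ × ℝ, ENNReal.ofReal |r * p.1 + p.2|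
          ∂((gaussianReal 0 (w * A / (w + A))).prod (gaussianReal 0 B)) := by
        rw [lintegral_mul_gaussianPDF_gaussianReal hw A
          (Measurable.lintegral_prod_right' (f := fun p : ℝ × ℝ => ENNReal.ofReal |r * p.1 + p.2|) (by fun_prop)),
          lintegral_prod _ (by fun_prop)]
    _ = _ := by
        rw [lintegral_abs_mul_add_gaussianReal, gaussianPDF,
          ← ENNReal.ofReal_mul (gaussianPDFReal_nonneg _ _ _)]
        congr 1
        have hwa : 0 < w + α := by positivity
        have hσ : r ^ 2 * ((w * A / (w + A) : ℝ≥0) : ℝ) + B = ((w + α) * γ - β ^ 2) / (w + α) := by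
          push_cast
          rw [hAc, hBc, ← hr]
          field_simp
          ring
        have hnn : 0 ≤ ((w + α) * γ - β ^ 2) / (w + α) := hσ ▸ by positivity
        have hnn' : 0 ≤ (w + α) * γ - β ^ 2 := by
          have := mul_nonneg hnn hwa.le
          rwa [div_mul_cancel₀ _ hwa.ne'] at this
        rw [hσ]
        simp only [gaussianPDFReal, NNReal.coe_add, hAc, sub_zero, ne_eq, OfNat.ofNat_ne_zero,
          not_false_eq_true, zero_pow, neg_zero, zero_div, Real.exp_zero, mul_one]
        rw [← Real.sqrt_inv, ← Real.sqrt_mul (by positivity),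
          show (2 * Real.pi * (w + α))⁻¹ * (2 * (((w + α) * γ - β ^ 2) / (w + α)) / Real.pi) =
            ((w + α) * γ - β ^ 2) / (Real.pi * (w + α)) ^ 2 by field_simp,
          Real.sqrt_div hnn', Real.sqrt_sq (by positivity)]

end LinearForms

/-! ### The Kac–Rice formula -/

/-- The Kac–Rice formula for a random combination of functions with independent Gaussian
coefficients, one of the functions being the constant `1`. -/
theorem lintegral_count_zeros_gaussian {n : ℕ} (i : Fin (n + 1)) (v : Fin (n + 1) → ℝ≥0)
    (hv : v i ≠ 0) {U : Set ℝ} (hU : IsOpen U) (ψ ψ' : Fin (n + 1) → ℝ → ℝ)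
    (hψm : ∀ k, Measurable (ψ k)) (hψm' : ∀ k, Measurable (ψ' k))
    (hψ : ∀ k, ∀ t ∈ U, HasStrictDerivAt (ψ k) (ψ' k t) t)
    (hi : ∀ t ∈ U, ψ i t = 1) (hi' : ∀ t ∈ U, ψ' i t = 0)
    (hmeas : Measurable fun x : Fin (n + 1) → ℝ =>
      Measure.count (U ∩ {t | ∑ k, x k * ψ k t = 0})) :
    ∫⁻ x : Fin (n + 1) → ℝ, Measure.count (U ∩ {t | ∑ k, x k * ψ k t = 0})
        ∂(Measure.pi fun k => gaussianReal 0 (v k)) =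
      ∫⁻ t in U, ENNReal.ofReal (√((∑ k, v k * ψ k t * ψ k t) * (∑ k, v k * ψ' k t * ψ' k t) -
        (∑ k, v k * ψ k t * ψ' k t) ^ 2) / (Real.pi * ∑ k, v k * ψ k t * ψ k t)) := by
  set P' := Measure.pi fun j : Fin n => gaussianReal 0 (v (i.succAbove j))
  have hmp := (measurePreserving_piFinSuccAbove (fun k => gaussianReal 0 (v k)) i).symm
  rw [← hmp.lintegral_comp_emb (MeasurableEquiv.measurableEmbedding _)]
  have hmeas' := (hmeas.comp hmp.measurable).aemeasurable
    (μ := (gaussianReal 0 (v i)).prod P')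
  simp only [Function.comp_def] at hmeas'
  rw [lintegral_prod_symm _ hmeas']
  -- With the other coefficients frozen, t is a zero exactly when coefficient i equals minus the
  -- remaining sum. Zeros are thus fibres of one smooth function over a Gaussian point, and the area
  -- formula applies.
  have hinner : ∀ y : Fin n → ℝ, ∫⁻ z, Measure.count (U ∩ {t | ∑ k,
      ((MeasurableEquiv.piFinSuccAbove (fun _ => ℝ) i).symm (z, y)) k * ψ k t = 0})
        ∂(gaussianReal 0 (v i)) =
      ∫⁻ t in U, ENNReal.ofReal |∑ j, ψ' (i.succAbove j) t * y j| *
        gaussianPDF 0 (v i) (-∑ j, ψ (i.succAbove j) t * y j) := by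
    intro y
    have hd : ∀ t ∈ U, HasStrictDerivAt (fun t => -∑ j, ψ (i.succAbove j) t * y j)
        (-∑ j, ψ' (i.succAbove j) t * y j) t := fun t ht =>
      (HasStrictDerivAt.fun_sum fun j _ => (hψ _ t ht).mul_const (y j)).neg
    rw [gaussianReal_of_var_ne_zero _ hv,
      lintegral_withDensity_eq_lintegral_mul_non_measurable _ (measurable_gaussianPDF _ _)
        (.of_forall fun _ => gaussianPDF_lt_top)]
    have hset : ∀ z, U ∩ {t | ∑ k,
        ((MeasurableEquiv.piFinSuccAbove (fun _ => ℝ) i).symm (z, y)) k * ψ k t = 0} =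
        U ∩ (fun t => -∑ j, ψ (i.succAbove j) t * y j) ⁻¹' {z} := by
      intro z
      ext t
      simp only [Set.mem_inter_iff, Set.mem_ofPred_eq, Set.mem_preimage, Set.mem_singleton_iff]
      refine and_congr_right fun ht => ?_
      rw [Fin.sum_univ_succAbove _ i, hi t ht]
      simp only [MeasurableEquiv.piFinSuccAbove_symm_apply, Fin.insertNthEquiv_apply,
        Fin.insertNth_apply_same, Fin.insertNth_apply_succAbove, mul_one, mul_comm (y _)]
      constructor <;> intro h <;> linarith
    simp only [Pi.mul_apply, hset]
    rw [lintegral_mul_count_fiber hU.measurableSet (fun t ht => by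
      rw [(hd t ht).hasDerivAt.deriv]; exact hd t ht) (measurable_gaussianPDF _ _)]
    refine setLIntegral_congr_fun hU.measurableSet fun t ht => ?_
    rw [(hd t ht).hasDerivAt.deriv, abs_neg]
  simp only [hinner]
  rw [lintegral_lintegral_swap]
  · refine setLIntegral_congr_fun hU.measurableSet fun t ht => ?_
    rw [lintegral_abs_mul_gaussianPDF (fun j => v (i.succAbove j)) hv _ _ rfl rfl rfl]
    -- Since ψ i = 1 and ψ' i = 0, restoring index i adds v i to the first sum only.
    simp only [Fin.sum_univ_succAbove _ i, hi t ht, hi' t ht, mul_one, mul_zero, zero_add]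
  · refine Measurable.aemeasurable ?_
    have h1 : Measurable fun p : (Fin n → ℝ) × ℝ =>
        ENNReal.ofReal |∑ j, ψ' (i.succAbove j) p.2 * p.1 j| :=
      ENNReal.measurable_ofReal.comp (measurable_norm.comp
        (Finset.measurable_fun_sum _ fun j _ => ((hψm' _).comp measurable_snd).mul
          ((measurable_pi_apply j).comp measurable_fst)))
    have h2 : Measurable fun p : (Fin n → ℝ) × ℝ =>
        gaussianPDF 0 (v i) (-∑ j, ψ (i.succAbove j) p.2 * p.1 j) :=
      (measurable_gaussianPDF _ _).comp (Measurable.neg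
        (Finset.measurable_fun_sum _ fun j _ => ((hψm _).comp measurable_snd).mul
          ((measurable_pi_apply j).comp measurable_fst)))
    exact h1.mul h2

/-! ### Stein identity and variance asymptotics -/

/-- Summation by parts for a distribution satisfying a first-order recurrence. -/
theorem sum_stein {d : ℕ} {p X Y : ℕ → ℝ} {τ : ℝ} (hX : X 0 = 0) (hY : Y 0 = 0)
    (hrec : ∀ k < d, X (k + 1) * p (k + 1) = τ * Y (d - k) * p k) (h : ℕ → ℝ) :
    ∑ k ∈ Finset.range (d + 1), p k * (X k * h k - τ * Y (d - k) * h (k + 1)) = 0 := by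
  simp only [mul_sub, Finset.sum_sub_distrib]
  rw [Finset.sum_range_succ', Finset.sum_range_succ (fun k => p k * (τ * Y (d - k) * h (k + 1)))]
  simp only [hX, hY, Nat.sub_self, zero_mul, mul_zero, add_zero]
  rw [sub_eq_zero]
  refine Finset.sum_congr rfl fun k hk => ?_
  linear_combination h (k + 1) * hrec k (Finset.mem_range.1 hk)

section Pointwise

variable {K d t c X Y q D : ℝ}

/-- D and q are the sum and difference of k - 1/4 and t (d + 3/4 - k). The shift 3/4 makes both ends
of the Stein identity exact: (D + q)/2 = k - 1/4 at k, while (D - q)/2 evaluated at k + 1 equals t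
(d - k - 1/4). -/
theorem stein_denominator_bounds (hK : 0 ≤ K) (hKd : K ≤ d) (ht : 0 < t) (ht1 : t ≤ 1)
    (hs : 1 ≤ t * d) (hq : q = (K - 1 / 4) - t * (d + 3 / 4 - K))
    (hD : D = (K - 1 / 4) + t * (d + 3 / 4 - K)) :
    3 / 4 * (t * d) ≤ D ∧ 3 / 4 ≤ D ∧ |q| ≤ 2 * D := by
  have h1 : 0 ≤ (1 - t) * K := mul_nonneg (by linarith) hK
  have h2 : 0 ≤ t * (d - K) := mul_nonneg ht.le (by linarith)
  have h3 : 3 / 4 * (t * d) ≤ D := by nlinarith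
  have h4 : 3 / 4 ≤ D := by linarith
  refine ⟨h3, h4, abs_le.2 ⟨by nlinarith, by nlinarith⟩⟩

theorem abs_div_le_of_abs_le {a b M s : ℝ} (hs : 0 < s) (hb : 3 / 4 * s ≤ b) (hb0 : 0 < b)
    (hM : 0 ≤ M) (ha : |a| ≤ M * (q ^ 2 + 1)) : |a / b| ≤ 4 / 3 * M * ((q ^ 2 + 1) / s) := by
  rw [abs_div, abs_of_pos hb0, div_le_iff₀ hb0]
  have h1 : (q ^ 2 + 1) / s * s = q ^ 2 + 1 := div_mul_cancel₀ _ hs.ne'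
  have h2 : 0 ≤ M * ((q ^ 2 + 1) / s) := by positivity
  nlinarith [mul_le_mul_of_nonneg_left hb h2]

/-- Test function 1/D. Writing D', q' for the values at k + 1, (D + q)²/(4D) - (D' - q')²/(4D')
equals (q + q')/2 plus (D - D')/4 and terms in q²/D - q'²/D'. All of this is q + O(1), because the
shifts are bounded and |q| ≤ 2D. -/
theorem stein_first_order (hK : 0 ≤ K) (hKd : K ≤ d) (ht : 0 < t) (ht1 : t ≤ 1)
    (hs : 1 ≤ t * d) (hq : q = (K - 1 / 4) - t * (d + 3 / 4 - K))
    (hD : D = (K - 1 / 4) + t * (d + 3 / 4 - K))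
    (hX : |X - (K - 1 / 4) ^ 2| ≤ c) (hY : |Y - (d - K - 1 / 4) ^ 2| ≤ c) :
    |X * (1 / D) - t ^ 2 * Y * (1 / (D + (1 - t))) - q| ≤ 6 + 3 * c := by
  obtain ⟨-, hD34, hqD⟩ := stein_denominator_bounds hK hKd ht ht1 hs hq hD
  have hc : 0 ≤ c := (abs_nonneg _).trans hX
  set D' := D + (1 - t) with hD'
  have hDpos : 0 < D := by linarith
  have hDD' : D ≤ D' := by linarith
  have hD'pos : 0 < D' := by linarith
  have e : X * (1 / D) - t ^ 2 * Y * (1 / D') - q =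
      (1 + t) / 2 - (1 - t) / 4 + (q ^ 2 * (1 - t) / (D * D') - (2 * (1 + t) * q + (1 + t) ^ 2) / D') / 4
        + (X - (K - 1 / 4) ^ 2) / D - t ^ 2 * (Y - (d - K - 1 / 4) ^ 2) / D' := by
    have e1 : K - 1 / 4 = (D + q) / 2 := by rw [hq, hD]; ring
    have e2 : t ^ 2 * (d - K - 1 / 4) ^ 2 = (D' - (q + (1 + t))) ^ 2 / 4 := by
      rw [hD', hq, hD]; ring
    rw [mul_sub (t ^ 2), e2, e1, show t = 1 + D - D' by rw [hD']; ring]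
    field_simp
    ring
  have b1 : |q ^ 2 * (1 - t) / (D * D')| ≤ 4 := by
    rw [abs_div, abs_of_pos (mul_pos hDpos hD'pos), div_le_iff₀ (mul_pos hDpos hD'pos),
      abs_of_nonneg (mul_nonneg (sq_nonneg _) (by linarith))]
    have : q ^ 2 ≤ 4 * D ^ 2 := by rw [← sq_abs]; nlinarith [abs_nonneg q]
    nlinarith [mul_le_mul_of_nonneg_left hDD' hDpos.le, sq_nonneg q]
  have b2 : |(2 * (1 + t) * q + (1 + t) ^ 2) / D'| ≤ 14 := by
    rw [abs_div, abs_of_pos hD'pos, div_le_iff₀ hD'pos]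
    have h1 : |2 * (1 + t) * q + (1 + t) ^ 2| ≤ 2 * (1 + t) * |q| + (1 + t) ^ 2 := by
      refine (abs_add_le _ _).trans ?_
      rw [abs_mul, abs_of_nonneg (by linarith : 0 ≤ 2 * (1 + t)), abs_of_nonneg (sq_nonneg (1 + t))]
    have h2 : (1 + t) * |q| ≤ 2 * |q| := by nlinarith [abs_nonneg q]
    nlinarith
  have b3 : |(X - (K - 1 / 4) ^ 2) / D| ≤ 4 / 3 * c := by
    rw [abs_div, abs_of_pos hDpos, div_le_iff₀ hDpos]
    nlinarith
  have b4 : |t ^ 2 * (Y - (d - K - 1 / 4) ^ 2) / D'| ≤ 4 / 3 * c := by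
    rw [abs_div, abs_of_pos hD'pos, div_le_iff₀ hD'pos, abs_mul, abs_of_nonneg (sq_nonneg t)]
    nlinarith [mul_le_mul (pow_le_one₀ ht.le ht1 : t ^ 2 ≤ 1) hY (abs_nonneg _) zero_le_one]
  rw [e]
  rw [abs_le] at b1 b2 b3 b4 ⊢
  constructor <;> linarith [b1.1, b1.2, b2.1, b2.2, b3.1, b3.2, b4.1, b4.2]

/-- Test function q/D. The squares now contribute (q² + q'²)/2, and (qD - q'D')/4 supplies the
deterministic term -td/2 because (1 + t) D = 2td + (1 - t) q + t. What remains is of size (q² +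
1)/D, and D is at least a multiple of td. -/
theorem stein_second_order (hK : 0 ≤ K) (hKd : K ≤ d) (ht : 0 < t) (ht1 : t ≤ 1)
    (hs : 1 ≤ t * d) (hq : q = (K - 1 / 4) - t * (d + 3 / 4 - K))
    (hD : D = (K - 1 / 4) + t * (d + 3 / 4 - K))
    (hX : |X - (K - 1 / 4) ^ 2| ≤ c) (hY : |Y - (d - K - 1 / 4) ^ 2| ≤ c) :
    |X * (q / D) - t ^ 2 * Y * ((q + (1 + t)) / (D + (1 - t))) -
      (q ^ 2 - t * d / 2 + ((1 + t) - (1 - t) / 2) * q +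
        ((1 + t) ^ 2 / 2 - t / 4 - (1 + t) * (1 - t) / 4))| ≤
      (6 + 6 * c) * ((q ^ 2 + 1) / (t * d)) := by
  obtain ⟨hDs, hD34, hqD⟩ := stein_denominator_bounds hK hKd ht ht1 hs hq hD
  have hc : 0 ≤ c := (abs_nonneg _).trans hX
  set D' := D + (1 - t) with hD'
  have hDpos : 0 < D := by linarith
  have hDD' : D ≤ D' := by linarith
  have hD'pos : 0 < D' := by linarith
  have hs0 : 0 < t * d := by linarith
  have e : X * (q / D) - t ^ 2 * Y * ((q + (1 + t)) / D') -
      (q ^ 2 - t * d / 2 + ((1 + t) - (1 - t) / 2) * q +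
        ((1 + t) ^ 2 / 2 - t / 4 - (1 + t) * (1 - t) / 4)) =
      q ^ 3 * (1 - t) / (D * D') / 4
        - (3 * q ^ 2 * (1 + t) + 3 * q * (1 + t) ^ 2 + (1 + t) ^ 3) / D' / 4
        + (X - (K - 1 / 4) ^ 2) * q / D
        - t ^ 2 * (Y - (d - K - 1 / 4) ^ 2) * (q + (1 + t)) / D' := by
    have e1 : K - 1 / 4 = (D + q) / 2 := by rw [hq, hD]; ring
    have e2 : t ^ 2 * (d - K - 1 / 4) ^ 2 = (D' - (q + (1 + t))) ^ 2 / 4 := by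
      rw [hD', hq, hD]; ring
    have e3 : t * d = ((1 + t) * D - (1 - t) * q - t) / 2 := by rw [hq, hD]; ring
    rw [mul_sub (t ^ 2), e2, e1, e3, show t = 1 + D - D' by rw [hD']; ring]
    field_simp
    ring
  set m := (q ^ 2 + 1) / (t * d) with hm
  have hm0 : 0 ≤ m := by positivity
  have inv : ∀ {a b M : ℝ}, 3 / 4 * (t * d) ≤ b → 0 < b → 0 ≤ M → |a| ≤ M * (q ^ 2 + 1) →
      |a / b| ≤ 4 / 3 * M * m := fun hb hb0 hM ha => abs_div_le_of_abs_le hs0 hb hb0 hM ha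
  have hq1 : |q| ≤ (q ^ 2 + 1) / 2 := by rw [← sq_abs]; nlinarith [sq_nonneg (|q| - 1)]
  have b1 : |q ^ 3 * (1 - t) / (D * D')| ≤ 4 / 3 * 2 * m := by
    rw [← div_div]
    refine inv (hDs.trans hDD') hD'pos (by norm_num) ?_
    rw [abs_div, abs_of_pos hDpos, div_le_iff₀ hDpos, abs_mul, abs_pow,
      abs_of_nonneg (by linarith : 0 ≤ 1 - t), ← sq_abs q]
    have h0 := abs_nonneg q
    have h1 : |q| ^ 3 * (1 - t) ≤ |q| ^ 3 := mul_le_of_le_one_right (by positivity) (by linarith)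
    have h2 : |q| ^ 3 ≤ |q| ^ 2 * (2 * D) := by
      rw [pow_succ]; exact mul_le_mul_of_nonneg_left hqD (by positivity)
    linarith
  have b2 : |(3 * q ^ 2 * (1 + t) + 3 * q * (1 + t) ^ 2 + (1 + t) ^ 3) / D'| ≤ 4 / 3 * 14 * m := by
    refine inv (hDs.trans hDD') hD'pos (by norm_num) ?_
    have h1 : (1 + t) ^ 2 ≤ 2 ^ 2 := pow_le_pow_left₀ (by linarith) (by linarith) 2
    have h2 : (1 + t) ^ 3 ≤ 2 ^ 3 := pow_le_pow_left₀ (by linarith) (by linarith) 3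
    have h3 : |3 * q * (1 + t) ^ 2| ≤ 12 * |q| := by
      rw [abs_mul, abs_mul, abs_of_nonneg (sq_nonneg (1 + t)), abs_of_pos (by norm_num : (0 : ℝ) < 3)]
      linarith [mul_le_mul_of_nonneg_left h1 (mul_nonneg (by norm_num : (0 : ℝ) ≤ 3) (abs_nonneg q))]
    have h4 : |3 * q ^ 2 * (1 + t)| ≤ 6 * q ^ 2 := by
      rw [abs_of_nonneg (by positivity)]
      linarith [mul_le_mul_of_nonneg_left (by linarith : 1 + t ≤ 2) (mul_nonneg (by norm_num : (0 : ℝ) ≤ 3) (sq_nonneg q))]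
    have h5 : |(1 + t) ^ 3| ≤ 2 ^ 3 := by rwa [abs_of_nonneg (by positivity)]
    refine (abs_add_le _ _).trans ?_
    refine (add_le_add (abs_add_le _ _) le_rfl).trans ?_
    linarith [sq_nonneg q]
  have b3 : |(X - (K - 1 / 4) ^ 2) * q / D| ≤ 4 / 3 * (c / 2) * m := by
    refine inv hDs hDpos (by positivity) ?_
    rw [abs_mul]
    linarith [mul_le_mul hX hq1 (abs_nonneg _) hc]
  have b4 : |t ^ 2 * (Y - (d - K - 1 / 4) ^ 2) * (q + (1 + t)) / D'| ≤ 4 / 3 * (5 / 2 * c) * m := by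
    refine inv (hDs.trans hDD') hD'pos (by positivity) ?_
    rw [abs_mul, abs_mul, abs_of_nonneg (sq_nonneg t)]
    have h1 : t ^ 2 * |Y - (d - K - 1 / 4) ^ 2| ≤ c := by
      linarith [mul_le_mul (pow_le_one₀ ht.le ht1 : t ^ 2 ≤ 1) hY (abs_nonneg _) zero_le_one]
    have h2 : |q + (1 + t)| ≤ 5 / 2 * (q ^ 2 + 1) := by
      refine (abs_add_le _ _).trans ?_
      rw [abs_of_pos (by linarith : 0 < 1 + t)]
      linarith [sq_nonneg q]
    calc _ ≤ c * (5 / 2 * (q ^ 2 + 1)) := mul_le_mul h1 h2 (abs_nonneg _) hc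
      _ = _ := by ring
  rw [e]
  have hcm : 0 ≤ c * m := mul_nonneg hc hm0
  rw [abs_le] at b1 b2 b3 b4 ⊢
  constructor <;> linarith [b1.1, b1.2, b2.1, b2.2, b3.1, b3.2, b4.1, b4.2]

end Pointwise

/-- Variance asymptotics for a distribution on `{0, …, d}` satisfying a first-order recurrence with
nearly quadratic coefficients. -/
theorem exists_abs_variance_sub_le (c : ℝ) : ∃ C : ℝ, ∀ (d : ℕ) (t : ℝ) (p X Y : ℕ → ℝ), 0 < t →
    t ≤ 1 → (∀ k, 0 ≤ p k) → ∑ k ∈ Finset.range (d + 1), p k = 1 → X 0 = 0 → Y 0 = 0 →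
    (∀ k < d, X (k + 1) * p (k + 1) = t ^ 2 * Y (d - k) * p k) →
    (∀ k ≤ d, |X k - ((k : ℝ) - 1 / 4) ^ 2| ≤ c) → (∀ k ≤ d, |Y k - ((k : ℝ) - 1 / 4) ^ 2| ≤ c) →
    0 ≤ ∑ k ∈ Finset.range (d + 1), p k * k ^ 2 - (∑ k ∈ Finset.range (d + 1), p k * k) ^ 2 →
    ∑ k ∈ Finset.range (d + 1), p k * k ^ 2 - (∑ k ∈ Finset.range (d + 1), p k * k) ^ 2 ≤
      c * (t * d) ^ 2 →
    |∑ k ∈ Finset.range (d + 1), p k * k ^ 2 - (∑ k ∈ Finset.range (d + 1), p k * k) ^ 2 -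
      t * d / (2 * (1 + t) ^ 2)| ≤ C := by
  -- The first four summands serve large s = td. The last two serve s ≤ 2 (6 + 6c), where the
  -- assumed bound c s² already suffices.
  refine ⟨(6 + 3 * c) ^ 2 + 2 * (6 + 3 * c) + 3 + (6 + 6 * c) * (4 * (6 + 3 * c) + 9) +
    c * (2 * (6 + 6 * c)) ^ 2 + 2 * (6 + 6 * c), ?_⟩
  intro d t p X Y ht ht1 hp hp1 hX0 hY0 hrec hX hY hV0 hV
  have hc : 0 ≤ c := (abs_nonneg _).trans (hX 0 (Nat.zero_le d))
  set V := ∑ k ∈ Finset.range (d + 1), p k * k ^ 2 - (∑ k ∈ Finset.range (d + 1), p k * k) ^ 2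
    with hVdef
  set s := t * (d : ℝ) with hs
  have hs0 : 0 ≤ s := by positivity
  have hfrac0 : 0 ≤ s / (2 * (1 + t) ^ 2) := by positivity
  have hfrac1 : s / (2 * (1 + t) ^ 2) ≤ s := div_le_self hs0 (by nlinarith)
  rcases le_total s (2 * (6 + 6 * c)) with hsmall | hlarge
  · have h1 : c * s ^ 2 ≤ c * (2 * (6 + 6 * c)) ^ 2 :=
      mul_le_mul_of_nonneg_left (pow_le_pow_left₀ hs0 hsmall 2) hc
    have h2 : 0 ≤ c * (2 * (6 + 6 * c)) ^ 2 := by positivity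
    have h3 : 0 ≤ (6 + 3 * c) ^ 2 + 2 * (6 + 3 * c) + 3 + (6 + 6 * c) * (4 * (6 + 3 * c) + 9) := by
      positivity
    rw [abs_le]
    constructor <;> linarith
  have hs1 : 1 ≤ s := by linarith
  set q : ℕ → ℝ := fun k => ((k : ℝ) - 1 / 4) - t * (d + 3 / 4 - k) with hq
  set D : ℕ → ℝ := fun k => ((k : ℝ) - 1 / 4) + t * (d + 3 / 4 - k) with hD
  have hqs : ∀ k, q (k + 1) = q k + (1 + t) := fun k => by simp only [hq]; push_cast; ring
  have hDs : ∀ k, D (k + 1) = D k + (1 - t) := fun k => by simp only [hD]; push_cast; ring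
  have hYk : ∀ k ≤ d, |Y (d - k) - ((d : ℝ) - k - 1 / 4) ^ 2| ≤ c := fun k hk => by
    have := hY (d - k) (Nat.sub_le _ _)
    rwa [Nat.cast_sub hk] at this
  have habs : ∀ {f g : ℕ → ℝ}, (∀ k ≤ d, |f k| ≤ g k) →
      |∑ k ∈ Finset.range (d + 1), p k * f k| ≤ ∑ k ∈ Finset.range (d + 1), p k * g k := by
    intro f g h
    refine (Finset.abs_sum_le_sum_abs _ _).trans (Finset.sum_le_sum fun k hk => ?_)
    rw [abs_mul, abs_of_nonneg (hp k)]
    exact mul_le_mul_of_nonneg_left (h k (Nat.lt_succ_iff.1 (Finset.mem_range.1 hk))) (hp k)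
  have st1 := sum_stein hX0 hY0 hrec fun k => 1 / D k
  have st2 := sum_stein hX0 hY0 hrec fun k => q k / D k
  simp only [hqs, hDs] at st1 st2
  have b1 := habs fun k hk => stein_first_order (K := k) (Nat.cast_nonneg k) (Nat.cast_le.2 hk) ht ht1
    hs1 rfl rfl (hX k hk) (hYk k hk)
  have b2 := habs fun k hk => stein_second_order (K := k) (Nat.cast_nonneg k) (Nat.cast_le.2 hk) ht
    ht1 hs1 rfl rfl (hX k hk) (hYk k hk)
  set m1 := ∑ k ∈ Finset.range (d + 1), p k * q k with hm1
  set m2 := ∑ k ∈ Finset.range (d + 1), p k * q k ^ 2 with hm2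
  set a := (1 + t) - (1 - t) / 2 with ha
  set b := (1 + t) ^ 2 / 2 - t / 4 - (1 + t) * (1 - t) / 4 with hb
  have e1 : |m1| ≤ 6 + 3 * c := by
    have h1 : ∑ k ∈ Finset.range (d + 1), p k * (X k * (1 / D k) -
        t ^ 2 * Y (d - k) * (1 / (D k + (1 - t))) - q k) = -m1 := by
      simp only [mul_sub (p _) _ (q _), Finset.sum_sub_distrib]
      rw [st1, zero_sub]
    rw [← abs_neg, ← h1]
    refine b1.trans (le_of_eq ?_)
    rw [← Finset.sum_mul, hp1, one_mul]
  have e2 : |m2 - s / 2 + a * m1 + b| ≤ (6 + 6 * c) * ((m2 + 1) / s) := by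
    have h1 : ∑ k ∈ Finset.range (d + 1), p k * (X k * (q k / D k) -
        t ^ 2 * Y (d - k) * ((q k + (1 + t)) / (D k + (1 - t))) -
        (q k ^ 2 - s / 2 + a * q k + b)) = -(m2 - s / 2 + a * m1 + b) := by
      simp only [mul_sub (p _) _ (_ + b), Finset.sum_sub_distrib]
      rw [st2, zero_sub]
      congr 1
      have : ∀ k, p k * (q k ^ 2 - s / 2 + a * q k + b) =
          p k * q k ^ 2 - p k * (s / 2) + a * (p k * q k) + p k * b := fun k => by ring
      simp only [this, Finset.sum_add_distrib, Finset.sum_sub_distrib]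
      rw [← Finset.mul_sum, ← Finset.sum_mul, ← Finset.sum_mul, hp1, one_mul, one_mul]
    rw [← abs_neg, ← h1]
    refine b2.trans (le_of_eq ?_)
    have : ∀ k, p k * ((6 + 6 * c) * ((q k ^ 2 + 1) / s)) =
        (6 + 6 * c) / s * (p k * q k ^ 2 + p k) := fun k => by ring
    refine (Finset.sum_congr rfl fun k _ => this k).trans ?_
    rw [← Finset.mul_sum, Finset.sum_add_distrib, hp1]
    ring
  -- q is affine in k with slope 1 + t.
  have e3 : (1 + t) ^ 2 * V = m2 - m1 ^ 2 := by
    set M := ∑ k ∈ Finset.range (d + 1), p k * k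
    have hq' : ∀ k, q k = (1 + t) * k + (-1 / 4 - t * (d + 3 / 4)) := fun k => by
      simp only [hq]; ring
    set z := -1 / 4 - t * ((d : ℝ) + 3 / 4)
    have h1 : m1 = (1 + t) * M + z := by
      have : ∀ k, p k * q k = (1 + t) * (p k * k) + p k * z := fun k => by rw [hq']; ring
      simp only [hm1, this, Finset.sum_add_distrib]
      rw [← Finset.mul_sum, ← Finset.sum_mul, hp1, one_mul]
    have h2 : m2 = (1 + t) ^ 2 * (∑ k ∈ Finset.range (d + 1), p k * k ^ 2) +
        2 * z * (1 + t) * M + z ^ 2 := by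
      have : ∀ k, p k * q k ^ 2 = (1 + t) ^ 2 * (p k * k ^ 2) + 2 * z * (1 + t) * (p k * k) +
        p k * z ^ 2 := fun k => by rw [hq']; ring
      simp only [hm2, this, Finset.sum_add_distrib]
      rw [← Finset.mul_sum, ← Finset.mul_sum, ← Finset.sum_mul, hp1, one_mul]
    rw [h1, h2, hVdef]
    ring
  have hm2 : 0 ≤ m2 := Finset.sum_nonneg fun k _ => mul_nonneg (hp k) (sq_nonneg _)
  have ha2 : |a * m1| ≤ 2 * (6 + 3 * c) := by
    rw [abs_mul, abs_of_nonneg (by rw [ha]; linarith)]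
    exact mul_le_mul (by rw [ha]; linarith) e1 (abs_nonneg _) (by norm_num)
  have hb3 : |b| ≤ 3 := by
    have h1 : (1 + t) ^ 2 ≤ 2 ^ 2 := pow_le_pow_left₀ (by linarith) (by linarith) 2
    have h2 : 0 ≤ (1 + t) * (1 - t) := mul_nonneg (by linarith) (by linarith)
    have h3 : (1 + t) * (1 - t) ≤ 2 * 1 := mul_le_mul (by linarith) (by linarith) (by linarith)
      (by norm_num)
    rw [hb, abs_le]
    constructor <;> linarith [sq_nonneg (1 + t)]
  have hspos : 0 < s := by linarith
  -- Bootstrap: for large s the error absorbs into half of m2, giving m2 ≤ s + O(1); fed back, this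
  -- makes the error O(1).
  have e4 : (6 + 6 * c) * ((m2 + 1) / s) ≤ (m2 + 1) / 2 := by
    rw [← mul_div_assoc, div_le_iff₀ hspos]
    linarith [mul_le_mul_of_nonneg_left hlarge (by linarith : 0 ≤ m2 + 1)]
  rw [abs_le] at e2 ha2 hb3
  have e5 : m2 ≤ s + 4 * (6 + 3 * c) + 7 := by linarith [e2.2, ha2.1, hb3.1]
  have e6 : (m2 + 1) / s ≤ 4 * (6 + 3 * c) + 9 := by
    rw [div_le_iff₀ hspos]
    linarith [le_mul_of_one_le_right (by positivity : 0 ≤ 4 * (6 + 3 * c) + 8) hs1]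
  have e7 : (6 + 6 * c) * ((m2 + 1) / s) ≤ (6 + 6 * c) * (4 * (6 + 3 * c) + 9) :=
    mul_le_mul_of_nonneg_left e6 (by positivity)
  have e8 : m1 ^ 2 ≤ (6 + 3 * c) ^ 2 := by rw [← sq_abs]; exact pow_le_pow_left₀ (abs_nonneg _) e1 2
  have e9 : |(1 + t) ^ 2 * V - s / 2| ≤
      (6 + 3 * c) ^ 2 + 2 * (6 + 3 * c) + 3 + (6 + 6 * c) * (4 * (6 + 3 * c) + 9) := by
    rw [e3, abs_le]
    constructor <;> linarith [e2.1, e2.2, ha2.1, ha2.2, hb3.1, hb3.2, sq_nonneg m1]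
  have e10 : V - s / (2 * (1 + t) ^ 2) = ((1 + t) ^ 2 * V - s / 2) / (1 + t) ^ 2 := by
    field_simp
  have h4 : 0 ≤ c * (2 * (6 + 6 * c)) ^ 2 := by positivity
  rw [e10, abs_div, abs_of_pos (by positivity : 0 < (1 + t) ^ 2)]
  refine (div_le_self (abs_nonneg _) (one_le_pow₀ (by linarith))).trans ?_
  linarith

/-! ### The recurrence for the coefficient variances -/

/-- The coefficient of the recurrence between the variances of the monomial coefficients. -/
noncomputable def recurrenceCoeff (v : ℝ≥0) (j : ℕ) : ℝ :=
  j * √(j * (j - 1)) + if j = 1 then v / √Real.pi else 0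

theorem recurrenceCoeff_zero (v : ℝ≥0) : recurrenceCoeff v 0 = 0 := by simp [recurrenceCoeff]

/-- At j = 1 the square root vanishes, so the correction term alone carries the recurrence across an
end coefficient. The factor 1/√π compensates for the √π present in interior variances but not in v.
-/
theorem recurrenceCoeff_one (v : ℝ≥0) : recurrenceCoeff v 1 = v / √Real.pi := by
  simp [recurrenceCoeff]

theorem recurrenceCoeff_add_two (v : ℝ≥0) (j : ℕ) :
    recurrenceCoeff v (j + 2) = (j + 2) * (√(j + 2) * √(j + 1)) := by
  have : j + 2 ≠ 1 := by omega
  rw [recurrenceCoeff, if_neg this, add_zero, ← Real.sqrt_mul (by positivity)]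
  push_cast
  ring_nf

/-- Expanding, x √(x (x - 1)) = x² - x/2 + O(1), and the linear term dictates the centre 1/4. -/
theorem abs_recurrenceCoeff_sub_le (v : ℝ≥0) (j : ℕ) :
    |recurrenceCoeff v j - ((j : ℝ) - 1 / 4) ^ 2| ≤ 1 + (v : ℝ) := by
  have hv : (0 : ℝ) ≤ v := v.2
  rcases j with _ | j
  · rw [recurrenceCoeff_zero, abs_le]; constructor <;> norm_num <;> linarith
  have h0 : 0 ≤ (if j + 1 = 1 then (v : ℝ) / √Real.pi else 0) ∧
      (if j + 1 = 1 then (v : ℝ) / √Real.pi else 0) ≤ v := by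
    split_ifs
    · refine ⟨by positivity, div_le_self hv ?_⟩
      rw [Real.one_le_sqrt]; linarith [Real.pi_gt_three]
    · exact ⟨le_rfl, hv⟩
  set r := (if j + 1 = 1 then (v : ℝ) / √Real.pi else 0) with hr
  rw [recurrenceCoeff, ← hr]
  push_cast
  set x : ℝ := (j : ℝ) + 1 with hx
  have hx1 : 1 ≤ x := by rw [hx]; linarith [Nat.cast_nonneg (α := ℝ) j]
  have h1 : √(x * (x - 1)) ≤ x - 1 / 2 := by
    rw [Real.sqrt_le_left (by linarith)]; nlinarith
  have h2 : x * (x - 1 / 2) - 1 / 2 ≤ x * √(x * (x - 1)) := by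
    have h3 : x - 1 / 2 - 1 / (2 * x) ≤ √(x * (x - 1)) := by
      apply Real.le_sqrt_of_sq_le
      have h4 : 1 / (2 * x) ≤ 1 / 2 := by
        rw [div_le_div_iff₀ (by positivity) (by norm_num)]; linarith
      have h5 : 0 < 1 / (2 * x) := by positivity
      have h6 : x * (1 / (2 * x)) = 1 / 2 := by field_simp
      nlinarith
    have h4 := mul_le_mul_of_nonneg_left h3 (by linarith : 0 ≤ x)
    have h6 : x * (1 / (2 * x)) = 1 / 2 := by field_simp
    nlinarith
  have h3 := mul_le_mul_of_nonneg_left h1 (by linarith : 0 ≤ x)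
  rw [abs_le]
  constructor <;> nlinarith [h0.1, h0.2]

/-- The variance of the coefficient of `t ^ k` after the substitution `z = t / (1 + t)`. -/
noncomputable def monomialVariance (v₀ v₁ : ℝ≥0) (d k : ℕ) : ℝ :=
  (d.choose k : ℝ) ^ 2 * coeffVariance v₀ v₁ d k

theorem coeffVariance_of_pos_of_lt (v₀ v₁ : ℝ≥0) {d k : ℕ} (hk : 0 < k) (hkd : k < d) :
    (coeffVariance v₀ v₁ d k : ℝ) = √Real.pi * √k * √((d : ℝ) - k) / √d := by
  have h1 : (k : ℝ) < d := by exact_mod_cast hkd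
  rw [coeffVariance, if_neg hk.ne', if_neg hkd.ne, Real.coe_toNNReal _ (by
    rw [stirlingFactor]; positivity), stirlingFactor, Real.sqrt_div (Nat.cast_nonneg d),
    Real.sqrt_mul (by positivity), Real.sqrt_mul (by positivity), one_div, inv_div]

/-- The squared ratio of consecutive binomials is ((d - k)/(k + 1))². Away from the ends the
variance ratio is √((k + 1)(d - k - 1)) / √(k (d - k)), and the product splits into a function of d
- k over a function of k + 1. The ends k = 0 and k + 1 = d are checked separately. -/
theorem recurrenceCoeff_mul_monomialVariance (v₀ v₁ : ℝ≥0) {d k : ℕ} (hd : 2 ≤ d) (hk : k < d) :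
    recurrenceCoeff v₀ (k + 1) * monomialVariance v₀ v₁ d (k + 1) =
      recurrenceCoeff v₁ (d - k) * monomialVariance v₀ v₁ d k := by
  have hch : (d.choose (k + 1) : ℝ) * (k + 1) = d.choose k * ((d : ℝ) - k) := by
    have := Nat.choose_succ_right_eq d k
    rw [← Nat.cast_sub hk.le]
    exact_mod_cast this
  have hpi : 0 < √Real.pi := Real.sqrt_pos.2 Real.pi_pos
  obtain ⟨m, rfl⟩ : ∃ m, d = k + 1 + m := ⟨d - k - 1, by omega⟩
  have hsub : k + 1 + m - k = m + 1 := by omega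
  rw [hsub]
  have hd0 : 0 < √((k + 1 + m : ℕ) : ℝ) := Real.sqrt_pos.2 (by exact_mod_cast (by omega))
  simp only [monomialVariance]
  have e1 : ((k + 1 + m : ℕ) : ℝ) - k = m + 1 := by push_cast; ring
  have e2 : ((k + 1 + m : ℕ) : ℝ) - ((k + 1 : ℕ) : ℝ) = m := by push_cast; ring
  rw [e1] at hch
  set A : ℝ := ((k + 1 + m).choose (k + 1) : ℝ)
  set B : ℝ := ((k + 1 + m).choose k : ℝ)
  have hch2 : A ^ 2 * (k + 1) ^ 2 = B ^ 2 * (m + 1) ^ 2 := by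
    rw [← mul_pow, hch, mul_pow]
  have mid : ∀ j : ℕ, 0 < j → j < k + 1 + m → _ := fun j hj hj' =>
    coeffVariance_of_pos_of_lt v₀ v₁ hj hj'
  rcases k with _ | k
  · obtain ⟨l, rfl⟩ : ∃ l, m = l + 1 := ⟨m - 1, by omega⟩
    rw [zero_add, recurrenceCoeff_one, mid 1 one_pos (by omega), recurrenceCoeff_add_two,
      show coeffVariance v₀ v₁ (0 + 1 + (l + 1)) 0 = v₀ by simp [coeffVariance]]
    have c1 : ((0 + 1 + (l + 1) : ℕ) : ℝ) = l + 2 := by push_cast; ring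
    have sq2 : √((l : ℝ) + 2) ^ 2 = l + 2 := Real.sq_sqrt (by positivity)
    have hR : √((l : ℝ) + 2) ≠ 0 := by positivity
    rw [e2, c1, Nat.cast_one, Real.sqrt_one, Nat.cast_succ]
    rw [Nat.cast_succ, Nat.cast_zero] at hch2
    field_simp
    rw [sq2]
    linear_combination (v₀ : ℝ) * hch2
  · rcases m with _ | m
    · rw [recurrenceCoeff_add_two, zero_add, recurrenceCoeff_one, mid (k + 1) (by omega) (by omega),
        show coeffVariance v₀ v₁ (k + 1 + 1 + 0) (k + 1 + 1) = v₁ by simp [coeffVariance]]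
      have c1 : ((k + 1 + 1 + 0 : ℕ) : ℝ) = k + 2 := by push_cast; ring
      have sq2 : √((k : ℝ) + 2) ^ 2 = k + 2 := Real.sq_sqrt (by positivity)
      have hR : √((k : ℝ) + 2) ≠ 0 := by positivity
      rw [e1, c1, Nat.cast_zero, zero_add, Real.sqrt_one, Nat.cast_succ]
      rw [Nat.cast_succ, Nat.cast_zero] at hch2
      field_simp
      rw [sq2]
      linear_combination (v₁ : ℝ) * hch2
    · rw [recurrenceCoeff_add_two, recurrenceCoeff_add_two, mid _ (by omega) (by omega),
        mid _ (by omega) (by omega), e1, e2]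
      have c1 : ((k + 1 + 1 : ℕ) : ℝ) = k + 2 := by push_cast; ring
      have c2 : ((m + 1 : ℕ) : ℝ) + 1 = m + 2 := by push_cast; ring
      have sq2 : √((k : ℝ) + 2) ^ 2 = k + 2 := Real.sq_sqrt (by positivity)
      have sq3 : √((m : ℝ) + 2) ^ 2 = m + 2 := Real.sq_sqrt (by positivity)
      rw [c1, c2, Nat.cast_succ m, Nat.cast_succ k]
      rw [Nat.cast_succ k, Nat.cast_succ m] at hch2
      field_simp
      rw [sq2, sq3]
      linear_combination hch2

theorem half_sq_le_recurrenceCoeff (v : ℝ≥0) {k : ℕ} (hk : 2 ≤ k) :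
    (k : ℝ) ^ 2 / 2 ≤ recurrenceCoeff v k := by
  obtain ⟨j, rfl⟩ := Nat.exists_eq_add_of_le' hk
  rw [recurrenceCoeff_add_two, ← Real.sqrt_mul (by positivity)]
  have hj : (0 : ℝ) ≤ j := Nat.cast_nonneg j
  have h1 : ((j : ℝ) + 2) / 2 ≤ √((j + 2) * (j + 1)) := Real.le_sqrt_of_sq_le (by nlinarith)
  push_cast
  nlinarith [mul_le_mul_of_nonneg_left h1 (by linarith : 0 ≤ (j : ℝ) + 2)]

theorem monomialVariance_nonneg (v₀ v₁ : ℝ≥0) (d k : ℕ) : 0 ≤ monomialVariance v₀ v₁ d k :=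
  mul_nonneg (sq_nonneg _) (coeffVariance v₀ v₁ d k).2

theorem coeffVariance_pos (v₀ v₁ : ℝ≥0) {d k : ℕ} (hk : 0 < k) (hkd : k < d) :
    0 < coeffVariance v₀ v₁ d k := by
  rw [← NNReal.coe_pos, coeffVariance_of_pos_of_lt v₀ v₁ hk hkd]
  have h1 : (0 : ℝ) < (d : ℝ) - k := sub_pos.2 (by exact_mod_cast hkd)
  have h2 : (0 : ℝ) < k := by exact_mod_cast hk
  have h3 : (0 : ℝ) < d := by exact_mod_cast hk.trans hkd
  have := Real.pi_pos
  positivity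

/-- The moments `∑ₖ kʲ wₖ t²ᵏ`, where `wₖ` are the variances of the monomial coefficients. -/
noncomputable def weightMoment (v₀ v₁ : ℝ≥0) (d j : ℕ) (t : ℝ) : ℝ :=
  ∑ k ∈ Finset.range (d + 1), monomialVariance v₀ v₁ d k * t ^ (2 * k) * (k : ℝ) ^ j

theorem weightMoment_zero_pos (v₀ v₁ : ℝ≥0) {d : ℕ} (hd : 2 ≤ d) {t : ℝ} (ht : 0 < t) :
    0 < weightMoment v₀ v₁ d 0 t := by
  refine Finset.sum_pos' (fun k _ => ?_) ⟨1, by simp; omega, ?_⟩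
  · have := monomialVariance_nonneg v₀ v₁ d k
    positivity
  · have h1 : (0 : ℝ) < coeffVariance v₀ v₁ d 1 :=
      NNReal.coe_pos.2 (coeffVariance_pos v₀ v₁ one_pos (by omega))
    have h2 : (0 : ℝ) < d.choose 1 := by exact_mod_cast Nat.choose_pos (by omega)
    rw [monomialVariance]
    positivity

/-- The variance of the exponent under the probability weights proportional to `wₖ t²ᵏ`. -/
noncomputable def exponentVariance (v₀ v₁ : ℝ≥0) (d : ℕ) (t : ℝ) : ℝ :=
  weightMoment v₀ v₁ d 2 t / weightMoment v₀ v₁ d 0 t -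
    (weightMoment v₀ v₁ d 1 t / weightMoment v₀ v₁ d 0 t) ^ 2

/-- The Stein identity with constant test function says E X(k) = t² E Y(d - k), which is O((td)²),
and X(k) dominates a squared deviation of k from a fixed centre. -/
theorem exists_variance_le_mul_sq (v₀ v₁ : ℝ≥0) : ∃ c : ℝ, 0 ≤ c ∧ ∀ (d : ℕ) (t : ℝ) (p : ℕ → ℝ),
    2 ≤ d → (∀ k, 0 ≤ p k) → ∑ k ∈ Finset.range (d + 1), p k = 1 → (v₀ = 0 → p 0 = 0) →
    (∀ k < d, recurrenceCoeff v₀ (k + 1) * p (k + 1) =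
      t ^ 2 * recurrenceCoeff v₁ (d - k) * p k) →
    ∑ k ∈ Finset.range (d + 1), p k * k ^ 2 - (∑ k ∈ Finset.range (d + 1), p k * k) ^ 2 ≤
      c * (t * d) ^ 2 := by
  -- The centre must be where X vanishes: 0 if v₀ ≠ 0. If v₀ = 0, then X(1) = 0 too, but 0 carries
  -- no mass, so the centre is 1.
  obtain ⟨a, κ, hκ, hak⟩ : ∃ a κ : ℝ, 0 ≤ κ ∧ ∀ k : ℕ, (v₀ = 0 → k ≠ 0) →
      ((k : ℝ) - a) ^ 2 ≤ κ * recurrenceCoeff v₀ k := by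
    rcases eq_or_ne v₀ 0 with hv | hv
    · refine ⟨1, 2, by norm_num, fun k hk => ?_⟩
      rcases Nat.lt_or_ge k 2 with h | h
      · have : k = 1 := by have := hk hv; omega
        subst this
        simp [recurrenceCoeff_one, hv]
      · have h1 := half_sq_le_recurrenceCoeff v₀ h
        have h2 : (2 : ℝ) ≤ k := by exact_mod_cast h
        nlinarith
    · have hv' : (0 : ℝ) < v₀ := NNReal.coe_pos.2 (pos_iff_ne_zero.2 hv)
      have hpi : 0 < √Real.pi := Real.sqrt_pos.2 Real.pi_pos
      refine ⟨0, 2 + √Real.pi / v₀, by positivity, fun k _ => ?_⟩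
      have hdiv : 0 < √Real.pi / v₀ := by positivity
      rcases k with _ | _ | k
      · simp [recurrenceCoeff_zero]
      · rw [zero_add, recurrenceCoeff_one, add_mul, div_mul_div_cancel₀ hv'.ne', div_self hpi.ne']
        norm_num
        positivity
      · have h1 := half_sq_le_recurrenceCoeff v₀ (k := k + 2) (by omega)
        have h2 : 0 ≤ recurrenceCoeff v₀ (k + 2) := le_trans (by positivity) h1
        have h3 := mul_nonneg hdiv.le h2
        simp only [sub_zero]
        linarith
  refine ⟨κ * (2 + v₁), by positivity, ?_⟩
  intro d t p hd hp hp1 hp0 hrec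
  have hd1 : (1 : ℝ) ≤ d := by exact_mod_cast (by omega : 1 ≤ d)
  have hst := sum_stein (recurrenceCoeff_zero v₀) (recurrenceCoeff_zero v₁) hrec fun _ => 1
  simp only [mul_one, mul_sub, Finset.sum_sub_distrib, sub_eq_zero] at hst
  have hvar : ∑ k ∈ Finset.range (d + 1), p k * k ^ 2 - (∑ k ∈ Finset.range (d + 1), p k * k) ^ 2 ≤
      ∑ k ∈ Finset.range (d + 1), p k * ((k : ℝ) - a) ^ 2 := by
    have : ∀ k : ℕ, p k * ((k : ℝ) - a) ^ 2 = p k * k ^ 2 - 2 * a * (p k * k) + p k * a ^ 2 :=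
      fun k => by ring
    simp only [this, Finset.sum_add_distrib, Finset.sum_sub_distrib]
    rw [← Finset.mul_sum, ← Finset.sum_mul, hp1]
    nlinarith [sq_nonneg (∑ k ∈ Finset.range (d + 1), p k * k - a)]
  calc _ ≤ ∑ k ∈ Finset.range (d + 1), p k * ((k : ℝ) - a) ^ 2 := hvar
    _ ≤ ∑ k ∈ Finset.range (d + 1), κ * (p k * recurrenceCoeff v₀ k) := by
        refine Finset.sum_le_sum fun k _ => ?_
        by_cases h : v₀ = 0 ∧ k = 0
        · rw [h.2, hp0 h.1]; simp
        · have := mul_le_mul_of_nonneg_left (hak k fun h1 h2 => h ⟨h1, h2⟩) (hp k)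
          linarith
    _ = κ * ∑ k ∈ Finset.range (d + 1), p k * (t ^ 2 * recurrenceCoeff v₁ (d - k)) := by
        rw [← Finset.mul_sum, hst]
    _ ≤ κ * ∑ k ∈ Finset.range (d + 1), p k * (t ^ 2 * ((2 + v₁) * d ^ 2)) := by
        refine mul_le_mul_of_nonneg_left (Finset.sum_le_sum fun k hk => ?_) hκ
        refine mul_le_mul_of_nonneg_left (mul_le_mul_of_nonneg_left ?_ (sq_nonneg t)) (hp k)
        have h1 := (abs_le.1 (abs_recurrenceCoeff_sub_le v₁ (d - k))).2
        have h2 : ((d - k : ℕ) : ℝ) ≤ d := by exact_mod_cast Nat.sub_le d k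
        have h3 : (((d - k : ℕ) : ℝ) - 1 / 4) ^ 2 ≤ (d : ℝ) ^ 2 :=
          sq_le_sq' (by linarith [Nat.cast_nonneg (α := ℝ) (d - k)]) (by linarith)
        have h4 : (1 : ℝ) ≤ (d : ℝ) ^ 2 := one_le_pow₀ hd1
        have h5 : (0 : ℝ) ≤ v₁ := v₁.2
        nlinarith
    _ = _ := by rw [← Finset.sum_mul, hp1]; ring

theorem exists_abs_exponentVariance_sub_le (v₀ v₁ : ℝ≥0) : ∃ C : ℝ, 0 ≤ C ∧ ∀ (d : ℕ) (t : ℝ),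
    2 ≤ d → 0 < t → t ≤ 1 → 0 ≤ exponentVariance v₀ v₁ d t ∧
      exponentVariance v₀ v₁ d t ≤ C * (t * d) ^ 2 ∧
      |exponentVariance v₀ v₁ d t - t * d / (2 * (1 + t) ^ 2)| ≤ C := by
  obtain ⟨c, hc, hcrude⟩ := exists_variance_le_mul_sq v₀ v₁
  obtain ⟨C, hC⟩ := exists_abs_variance_sub_le (1 + v₀ + v₁ + c)
  refine ⟨max c C, le_max_of_le_left hc, ?_⟩
  intro d t hd ht ht1
  have hA := weightMoment_zero_pos v₀ v₁ hd ht
  set A := weightMoment v₀ v₁ d 0 t with hAdef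
  set p : ℕ → ℝ := fun k => monomialVariance v₀ v₁ d k * t ^ (2 * k) / A with hp
  have hmom : ∀ j, ∑ k ∈ Finset.range (d + 1), p k * (k : ℝ) ^ j = weightMoment v₀ v₁ d j t / A := by
    intro j
    rw [weightMoment, Finset.sum_div]
    exact Finset.sum_congr rfl fun k _ => by simp only [hp]; ring
  have hp0 : ∀ k, 0 ≤ p k := fun k => by
    have := monomialVariance_nonneg v₀ v₁ d k
    simp only [hp]; positivity
  have hp1 : ∑ k ∈ Finset.range (d + 1), p k = 1 := by
    have := hmom 0
    simpa [← hAdef, div_self hA.ne'] using this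
  have hV : ∑ k ∈ Finset.range (d + 1), p k * k ^ 2 - (∑ k ∈ Finset.range (d + 1), p k * k) ^ 2 =
      exponentVariance v₀ v₁ d t := by
    have h1 := hmom 1
    simp only [pow_one] at h1
    rw [exponentVariance, hmom 2, h1]
  have hrec : ∀ k < d, recurrenceCoeff v₀ (k + 1) * p (k + 1) =
      t ^ 2 * recurrenceCoeff v₁ (d - k) * p k := by
    intro k hk
    have := recurrenceCoeff_mul_monomialVariance v₀ v₁ hd hk
    simp only [hp]
    field_simp
    rw [show t ^ (2 * (k + 1)) = t ^ 2 * t ^ (2 * k) by ring]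
    linear_combination t ^ 2 * t ^ (2 * k) * this
  have hv0 : v₀ = 0 → p 0 = 0 := by
    rintro rfl
    simp [hp, monomialVariance, coeffVariance]
  have hVnn : 0 ≤ exponentVariance v₀ v₁ d t := by
    rw [← hV]
    set M := ∑ k ∈ Finset.range (d + 1), p k * k
    have h1 : 0 ≤ ∑ k ∈ Finset.range (d + 1), p k * ((k : ℝ) - M) ^ 2 :=
      Finset.sum_nonneg fun k _ => mul_nonneg (hp0 k) (sq_nonneg _)
    have : ∀ k : ℕ, p k * ((k : ℝ) - M) ^ 2 = p k * k ^ 2 - 2 * M * (p k * k) + p k * M ^ 2 :=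
      fun k => by ring
    simp only [this, Finset.sum_add_distrib, Finset.sum_sub_distrib] at h1
    rw [← Finset.mul_sum, ← Finset.sum_mul, hp1] at h1
    linarith
  have hcr := hcrude d t p hd hp0 hp1 hv0 hrec
  have hv0' : (0 : ℝ) ≤ v₀ := v₀.2
  have hv1' : (0 : ℝ) ≤ v₁ := v₁.2
  have hmain := hC d t p (recurrenceCoeff v₀) (recurrenceCoeff v₁) ht ht1 hp0 hp1
    (recurrenceCoeff_zero v₀) (recurrenceCoeff_zero v₁) hrec
    (fun k _ => (abs_recurrenceCoeff_sub_le v₀ k).trans (by linarith))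
    (fun k _ => (abs_recurrenceCoeff_sub_le v₁ k).trans (by linarith))
    (hV ▸ hVnn) (hcr.trans (mul_le_mul_of_nonneg_right (by linarith) (sq_nonneg _)))
  rw [hV] at hcr hmain
  exact ⟨hVnn, hcr.trans (mul_le_mul_of_nonneg_right (le_max_left _ _) (sq_nonneg _)),
    hmain.trans (le_max_right _ _)⟩

/-! ### The expected number of zeros in the unit interval -/

theorem exists_abs_sqrt_exponentVariance_sub_le (v₀ v₁ : ℝ≥0) : ∃ C : ℝ, ∀ (d : ℕ) (t : ℝ),
    2 ≤ d → 0 < t → t ≤ 1 →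
      |√(exponentVariance v₀ v₁ d t) - √(t * d / 2) / (1 + t)| ≤
        C * (√(t * d) / (1 + t * d)) := by
  obtain ⟨C, hC, h⟩ := exists_abs_exponentVariance_sub_le v₀ v₁
  refine ⟨8 * C + 2 * √C + 2, fun d t hd ht ht1 => ?_⟩
  obtain ⟨hV0, hV1, hV2⟩ := h d t hd ht ht1
  set V := exponentVariance v₀ v₁ d t
  set s := t * (d : ℝ) with hs
  have hspos : 0 < s := mul_pos ht (by exact_mod_cast (by omega : 0 < d))
  have hsq : 0 < √s := Real.sqrt_pos.2 hspos
  have hss : √s * √s = s := Real.mul_self_sqrt hspos.le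
  set b := √(s / 2) / (1 + t) with hb
  have hbb : b ^ 2 = s / (2 * (1 + t) ^ 2) := by
    rw [hb, div_pow, Real.sq_sqrt (by positivity)]
    field_simp
  have hbpos : 0 < b := by positivity
  have hC' : 0 ≤ √C := Real.sqrt_nonneg C
  rw [← mul_div_assoc, le_div_iff₀ (by positivity)]
  -- For s ≤ 1 both terms are O(√s) separately. For s ≥ 1 divide |V - b²| ≤ C by √V + b ≥ √s / 4.
  rcases le_total s 1 with h1 | h1
  · have hV3 : √V ≤ √C * s := by
      rw [← Real.sqrt_sq hspos.le, ← Real.sqrt_mul hC]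
      exact Real.sqrt_le_sqrt hV1
    have hsle : s ≤ √s := Real.le_sqrt_of_sq_le (by nlinarith)
    have hb2 : b ≤ √s := by
      refine (div_le_self (Real.sqrt_nonneg _) (by linarith)).trans (Real.sqrt_le_sqrt (by linarith))
    have h3 : |√V - b| ≤ (√C + 1) * √s := by
      have h4 := mul_le_mul_of_nonneg_left hsle hC'
      rw [abs_le]
      constructor <;> nlinarith [Real.sqrt_nonneg V]
    have h5 : 0 ≤ (√C + 1) * √s := by positivity
    calc |√V - b| * (1 + s) ≤ ((√C + 1) * √s) * 2 :=
          mul_le_mul h3 (by linarith) (by linarith) h5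
      _ ≤ _ := by nlinarith [mul_nonneg hC hsq.le]
  · have h2 : |√V - b| * (√V + b) ≤ C := by
      rw [← abs_of_nonneg (add_nonneg (Real.sqrt_nonneg V) hbpos.le), ← abs_mul]
      have : (√V - b) * (√V + b) = V - s / (2 * (1 + t) ^ 2) := by
        rw [← hbb]
        linear_combination Real.mul_self_sqrt hV0
      rwa [this]
    have h3 : √s / 4 ≤ b := by
      rw [hb, div_le_div_iff₀ (by norm_num) (by positivity)]
      have h4 : √s / 2 ≤ √(s / 2) := by
        apply Real.le_sqrt_of_sq_le
        nlinarith
      nlinarith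
    have h5 : |√V - b| * (√s / 4) ≤ C :=
      (mul_le_mul_of_nonneg_left (h3.trans (by linarith [Real.sqrt_nonneg V])) (abs_nonneg _)).trans h2
    calc |√V - b| * (1 + s) ≤ |√V - b| * (2 * s) :=
          mul_le_mul_of_nonneg_left (by linarith) (abs_nonneg _)
      _ = |√V - b| * (√s / 4) * (8 * √s) := by linear_combination (-2 * |√V - b|) * hss
      _ ≤ C * (8 * √s) := mul_le_mul_of_nonneg_right h5 (by positivity)
      _ ≤ _ := by nlinarith [mul_nonneg hC' hsq.le]

/-- Used with a = 1 for the main term, where arctan 1 = π/4, and with a = d for the error, which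
stays below π for every d. -/
theorem integral_sqrt_div_one_add {a : ℝ} (ha : 0 < a) :
    IntegrableOn (fun t => √(a * t) / (1 + a * t) / t) (Set.Ioo 0 1) ∧
      ∫ t in Set.Ioo (0 : ℝ) 1, √(a * t) / (1 + a * t) / t = 2 * Real.arctan √a := by
  have hder : ∀ t ∈ Set.Ioo (0 : ℝ) 1,
      HasDerivAt (fun t => 2 * Real.arctan √(a * t)) (√(a * t) / (1 + a * t) / t) t := by
    intro t ht
    have hat : 0 < a * t := mul_pos ha ht.1
    have h1 : HasDerivAt (fun t => a * t) a t := by simpa using (hasDerivAt_id t).const_mul a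
    have h2 := ((h1.sqrt hat.ne').arctan).const_mul 2
    refine h2.congr_deriv ?_
    have hsq : √(a * t) ^ 2 = a * t := Real.sq_sqrt hat.le
    have hs : 0 < √(a * t) := Real.sqrt_pos.2 hat
    rw [hsq]
    have ht0 := ht.1
    field_simp
    rw [hsq]
  have hcont : ContinuousOn (fun t => 2 * Real.arctan √(a * t)) (Set.Icc 0 1) := by
    fun_prop
  have hint := intervalIntegral.integrableOn_deriv_of_nonneg hcont hder fun t ht => by
    have := mul_pos ha ht.1
    have := ht.1
    positivity
  refine ⟨hint.mono_set Set.Ioo_subset_Ioc_self, ?_⟩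
  rw [← integral_Ioc_eq_integral_Ioo, ← intervalIntegral.integral_of_le zero_le_one,
    intervalIntegral.integral_eq_sub_of_hasDerivAt_of_le zero_le_one hcont hder
      ((intervalIntegrable_iff_integrableOn_Ioc_of_le zero_le_one).2 hint)]
  simp

theorem exists_lintegral_exponentVariance (v₀ v₁ : ℝ≥0) : ∃ C : ℝ, ∀ d : ℕ, 2 ≤ d →
    ∃ r : ℝ, 0 ≤ r ∧ |r - √(2 * (d : ℝ)) / 4| ≤ C ∧
      ∫⁻ t in Set.Ioo (0 : ℝ) 1, ENNReal.ofReal (√(exponentVariance v₀ v₁ d t) / (Real.pi * t)) =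
        ENNReal.ofReal r := by
  obtain ⟨C, hC⟩ := exists_abs_sqrt_exponentVariance_sub_le v₀ v₁
  refine ⟨|C|, fun d hd => ?_⟩
  have hd0 : (0 : ℝ) < d := by exact_mod_cast (by omega : 0 < d)
  have hpi := Real.pi_pos
  set f : ℝ → ℝ := fun t => √(exponentVariance v₀ v₁ d t) / (Real.pi * t) with hf
  set f₀ : ℝ → ℝ := fun t => √(d / 2) / Real.pi * (√(1 * t) / (1 + 1 * t) / t) with hf₀
  set g : ℝ → ℝ := fun t => |C| / Real.pi * (√(d * t) / (1 + d * t) / t) with hg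
  obtain ⟨hi1, he1⟩ := integral_sqrt_div_one_add one_pos
  obtain ⟨hid, hed⟩ := integral_sqrt_div_one_add hd0
  have hf₀i : IntegrableOn f₀ (Set.Ioo 0 1) := hi1.const_mul _
  have hgi : IntegrableOn g (Set.Ioo 0 1) := hid.const_mul _
  have hf₀e : ∫ t in Set.Ioo (0 : ℝ) 1, f₀ t = √(2 * (d : ℝ)) / 4 := by
    simp only [hf₀]
    rw [integral_const_mul, he1, Real.sqrt_one, Real.arctan_one,
      show (2 : ℝ) * d = 2 ^ 2 * (d / 2) by ring, Real.sqrt_mul (by norm_num),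
      Real.sqrt_sq (by norm_num)]
    field_simp
  have hge : ∫ t in Set.Ioo (0 : ℝ) 1, g t ≤ |C| := by
    simp only [hg]
    rw [integral_const_mul, hed]
    have h1 := (Real.arctan_lt_pi_div_two √d).le
    calc |C| / Real.pi * (2 * Real.arctan √d) ≤ |C| / Real.pi * (2 * (Real.pi / 2)) := by gcongr
      _ = |C| := by field_simp
  have hbound : ∀ t ∈ Set.Ioo (0 : ℝ) 1, |f t - f₀ t| ≤ g t := by
    intro t ht
    have ht0 := ht.1
    have h1 := hC d t hd ht.1 ht.2.le
    have e1 : f t - f₀ t = (√(exponentVariance v₀ v₁ d t) - √(t * d / 2) / (1 + t)) *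
        (1 / (Real.pi * t)) := by
      simp only [hf, hf₀, one_mul]
      rw [show t * d / 2 = d / 2 * t by ring, Real.sqrt_mul (by positivity)]
      field_simp
    have e2 : g t = |C| * (√(t * d) / (1 + t * d)) * (1 / (Real.pi * t)) := by
      simp only [hg]
      rw [mul_comm (d : ℝ) t]
      field_simp
    rw [e1, e2, abs_mul, abs_of_pos (by positivity : 0 < 1 / (Real.pi * t))]
    refine mul_le_mul_of_nonneg_right (h1.trans ?_) (by positivity)
    exact mul_le_mul_of_nonneg_right (le_abs_self C) (by positivity)
  have hfm : Measurable f := by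
    simp only [hf, exponentVariance, weightMoment]
    fun_prop
  have hdi : IntegrableOn (fun t => f t - f₀ t) (Set.Ioo 0 1) := by
    refine hgi.mono' (hfm.aestronglyMeasurable.sub hf₀i.aestronglyMeasurable) ?_
    filter_upwards [ae_restrict_mem measurableSet_Ioo] with t ht
    exact hbound t ht
  have hfi : IntegrableOn f (Set.Ioo 0 1) := by
    have := hdi.add hf₀i
    refine this.congr (.of_forall fun t => ?_)
    simp
  have hfnn : 0 ≤ᵐ[volume.restrict (Set.Ioo (0 : ℝ) 1)] f := by
    filter_upwards [ae_restrict_mem measurableSet_Ioo] with t ht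
    have := ht.1
    simp only [hf, Pi.zero_apply]
    positivity
  refine ⟨∫ t in Set.Ioo (0 : ℝ) 1, f t, integral_nonneg_of_ae hfnn, ?_, ?_⟩
  · rw [← hf₀e, ← integral_sub hfi hf₀i]
    refine (abs_integral_le_integral_abs).trans (le_trans ?_ hge)
    exact setIntegral_mono_on hdi.abs hgi measurableSet_Ioo hbound
  · rw [ofReal_integral_eq_lintegral_ofReal hfi hfnn]

theorem lintegral_count_zeros_unitInterval (v₀ v₁ : ℝ≥0) {d : ℕ} (hd : 2 ≤ d) :
    ∫⁻ x : Fin (d + 1) → ℝ, Measure.count (Set.Ioo (0 : ℝ) 1 ∩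
        {t | ∑ k : Fin (d + 1), x k * (d.choose k * t ^ (k : ℕ)) = 0})
        ∂(Measure.pi fun k : Fin (d + 1) => gaussianReal 0 (coeffVariance v₀ v₁ d k)) =
      ∫⁻ t in Set.Ioo (0 : ℝ) 1,
        ENNReal.ofReal (√(exponentVariance v₀ v₁ d t) / (Real.pi * t)) := by
  have hd0 : (0 : ℝ) < d := by exact_mod_cast (by omega : 0 < d)
  -- Dividing by d t keeps the zeros in (0, 1) and makes the function of index 1 constant. Index 1
  -- is used because the end coefficients may have variance 0.
  set ψ : Fin (d + 1) → ℝ → ℝ := fun k t => d.choose k / d * t ^ ((k : ℤ) - 1) with hψ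
  set ψ' : Fin (d + 1) → ℝ → ℝ := fun k t =>
    d.choose k / d * ((((k : ℤ) - 1 : ℤ) : ℝ) * t ^ ((k : ℤ) - 1 - 1)) with hψ'
  have hset : ∀ x : Fin (d + 1) → ℝ, Set.Ioo (0 : ℝ) 1 ∩
      {t | ∑ k : Fin (d + 1), x k * (d.choose k * t ^ (k : ℕ)) = 0} =
      Set.Ioo (0 : ℝ) 1 ∩ {t | ∑ k, x k * ψ k t = 0} := by
    intro x
    ext t
    simp only [Set.mem_inter_iff, Set.mem_ofPred_eq]
    refine and_congr_right fun ht => ?_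
    have ht0 := ht.1
    have : ∑ k, x k * ψ k t =
        (∑ k : Fin (d + 1), x k * (d.choose k * t ^ (k : ℕ))) * (1 / (d * t)) := by
      rw [Finset.sum_mul]
      refine Finset.sum_congr rfl fun k _ => ?_
      simp only [hψ]
      rw [zpow_sub_one₀ ht0.ne', zpow_natCast]
      field_simp
    rw [this, mul_eq_zero, or_iff_left (by positivity)]
  have hmeas : Measurable fun x : Fin (d + 1) → ℝ => Measure.count (Set.Ioo (0 : ℝ) 1 ∩
      {t | ∑ k : Fin (d + 1), x k * (d.choose k * t ^ (k : ℕ)) = 0}) :=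
    measurable_count_section (Z := {p : (Fin (d + 1) → ℝ) × ℝ |
      ∑ k : Fin (d + 1), p.1 k * (d.choose k * p.2 ^ (k : ℕ)) = 0})
      (isClosed_eq (by fun_prop) continuous_const) isOpen_Ioo
  simp only [hset] at hmeas ⊢
  have h1d : 1 < d + 1 := by omega
  rw [lintegral_count_zeros_gaussian ⟨1, h1d⟩ _ (coeffVariance_pos v₀ v₁ one_pos (by omega)).ne'
    isOpen_Ioo ψ ψ' (fun k => by fun_prop) (fun k => by fun_prop)
    (fun k t ht => (hasStrictDerivAt_zpow _ t (Or.inl ht.1.ne')).const_mul _)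
    (fun t ht => by simp [hψ, hd0.ne']) (fun t ht => by simp [hψ']) hmeas]
  refine setLIntegral_congr_fun measurableSet_Ioo fun t ht => ?_
  have ht0 := ht.1
  set S := fun j => weightMoment v₀ v₁ d j t with hS
  have hS0 : 0 < S 0 := weightMoment_zero_pos v₀ v₁ hd ht.1
  have hz1 : ∀ k : ℕ, t ^ ((k : ℤ) - 1) = t ^ k / t := fun k => by
    rw [zpow_sub_one₀ ht0.ne', zpow_natCast]; rfl
  have hz2 : ∀ k : ℕ, t ^ ((k : ℤ) - 1 - 1) = t ^ k / t ^ 2 := fun k => by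
    rw [zpow_sub_one₀ ht0.ne', hz1, pow_two, ← div_div]; rfl
  have hsum : ∀ j, S j = ∑ k : Fin (d + 1),
      monomialVariance v₀ v₁ d k * t ^ (2 * (k : ℕ)) * (k : ℝ) ^ j := fun j =>
    Finset.sum_range _
  have e0 : ∑ k : Fin (d + 1), (coeffVariance v₀ v₁ d k : ℝ) * ψ k t * ψ k t =
      S 0 / (d ^ 2 * t ^ 2) := by
    rw [hsum, Finset.sum_div]
    refine Finset.sum_congr rfl fun k _ => ?_
    simp only [hψ, hz1, monomialVariance]
    field_simp
    ring
  have e1 : ∑ k : Fin (d + 1), (coeffVariance v₀ v₁ d k : ℝ) * ψ k t * ψ' k t =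
      (S 1 - S 0) / (d ^ 2 * t ^ 3) := by
    rw [hsum, hsum, ← Finset.sum_sub_distrib, Finset.sum_div]
    refine Finset.sum_congr rfl fun k _ => ?_
    simp only [hψ, hψ', hz1, hz2, monomialVariance]
    push_cast
    field_simp
    ring
  have e2 : ∑ k : Fin (d + 1), (coeffVariance v₀ v₁ d k : ℝ) * ψ' k t * ψ' k t =
      (S 2 - 2 * S 1 + S 0) / (d ^ 2 * t ^ 4) := by
    rw [hsum, hsum, hsum, Finset.mul_sum, ← Finset.sum_sub_distrib, ← Finset.sum_add_distrib,
      Finset.sum_div]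
    refine Finset.sum_congr rfl fun k _ => ?_
    simp only [hψ', hz2, monomialVariance]
    push_cast
    field_simp
    ring
  have e3 : exponentVariance v₀ v₁ d t = (S 0 * S 2 - S 1 ^ 2) / (S 0) ^ 2 := by
    simp only [exponentVariance, hS]
    have := hS0.ne'
    simp only [hS] at this
    field_simp
  simp only [e0, e1, e2, e3]
  congr 1
  rw [show S 0 / (d ^ 2 * t ^ 2) * ((S 2 - 2 * S 1 + S 0) / (d ^ 2 * t ^ 4)) -
      ((S 1 - S 0) / (d ^ 2 * t ^ 3)) ^ 2 = (S 0 * S 2 - S 1 ^ 2) / (d ^ 2 * t ^ 3) ^ 2 by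
    field_simp; ring, Real.sqrt_div' _ (by positivity), Real.sqrt_div' _ (by positivity),
    Real.sqrt_sq (by positivity), Real.sqrt_sq hS0.le]
  field_simp

/-! ### Symmetries and the four charts of the real line -/

/-- The number of zeros of `∑ₖ xₖ (d choose k) tᵏ` in the open unit interval. -/
noncomputable def unitIntervalZeros (d : ℕ) (x : Fin (d + 1) → ℝ) : ENNReal :=
  Measure.count (Set.Ioo (0 : ℝ) 1 ∩
    {t | ∑ k : Fin (d + 1), x k * (d.choose k * t ^ (k : ℕ)) = 0})

theorem measurable_unitIntervalZeros (d : ℕ) : Measurable (unitIntervalZeros d) :=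
  measurable_count_section (Z := {p : (Fin (d + 1) → ℝ) × ℝ |
    ∑ k : Fin (d + 1), p.1 k * (d.choose k * p.2 ^ (k : ℕ)) = 0})
    (isClosed_eq (by fun_prop) continuous_const) isOpen_Ioo

universe u

theorem exists_lintegral_unitIntervalZeros (v₀ v₁ : ℝ≥0) : ∃ C : ℝ, ∀ d : ℕ, 2 ≤ d →
    ∃ r : ℝ, 0 ≤ r ∧ |r - √(2 * (d : ℝ)) / 4| ≤ C ∧
      ∀ {Ω : Type u} [MeasurableSpace Ω] (μ : Measure Ω) [IsProbabilityMeasure μ]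
        (b : Fin (d + 1) → Ω → ℝ), iIndepFun b μ →
        (∀ k : Fin (d + 1), HasLaw (b k) (gaussianReal 0 (coeffVariance v₀ v₁ d (k : ℕ))) μ) →
        ∫⁻ ω, unitIntervalZeros d (fun k => b k ω) ∂μ = ENNReal.ofReal r := by
  obtain ⟨C, hC⟩ := exists_lintegral_exponentVariance v₀ v₁
  refine ⟨C, fun d hd => ?_⟩
  obtain ⟨r, hr0, hr, hint⟩ := hC d hd
  refine ⟨r, hr0, hr, fun {Ω} _ μ _ b hb hl => ?_⟩
  have hlaw := (iIndepFun_iff_map_fun_eq_pi_map fun k => (hl k).aemeasurable).1 hb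
  simp only [fun k => (hl k).map_eq] at hlaw
  rw [← hint, ← lintegral_count_zeros_unitInterval v₀ v₁ hd, ← hlaw]
  exact (lintegral_map' (measurable_unitIntervalZeros d).aemeasurable
    (aemeasurable_pi_lambda _ fun k => (hl k).aemeasurable)).symm

theorem coeffVariance_sub (v₀ v₁ : ℝ≥0) {d k : ℕ} (hd : 2 ≤ d) (hk : k ≤ d) :
    coeffVariance v₀ v₁ d (d - k) = coeffVariance v₁ v₀ d k := by
  rcases Nat.eq_zero_or_pos k with rfl | hk0
  · have : d ≠ 0 := by omega
    simp [coeffVariance, this]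
  rcases hk.eq_or_lt with rfl | hkd
  · have : k ≠ 0 := by omega
    simp [coeffVariance, this]
  rw [← NNReal.coe_inj, coeffVariance_of_pos_of_lt _ _ (by omega) (by omega),
    coeffVariance_of_pos_of_lt _ _ hk0 hkd, Nat.cast_sub hk, sub_sub_cancel]
  ring

section Law

variable {Ω : Type u} [MeasurableSpace Ω] {μ : Measure Ω} {d : ℕ} {v : ℕ → ℝ≥0}
  {b : Fin (d + 1) → Ω → ℝ}

theorem hasLaw_neg_one_pow_mul
    (hl : ∀ k : Fin (d + 1), HasLaw (b k) (gaussianReal 0 (v (k : ℕ))) μ) (k : Fin (d + 1)) :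
    HasLaw (fun ω => (-1) ^ (k : ℕ) * b k ω) (gaussianReal 0 (v (k : ℕ))) μ := by
  convert gaussianReal_const_mul (hl k) ((-1) ^ (k : ℕ)) using 2
  · simp
  · rw [← NNReal.coe_inj]
    simp [← pow_mul, mul_comm _ 2]

theorem iIndepFun_neg_one_pow_mul (hb : iIndepFun b μ) :
    iIndepFun (fun (k : Fin (d + 1)) ω => (-1) ^ (k : ℕ) * b k ω) μ :=
  hb.comp (fun k x => (-1) ^ (k : ℕ) * x) fun k => by fun_prop

end Law

/-- The homogeneous form `∑ₖ xₖ (d choose k) aᵏ cᵈ⁻ᵏ`. -/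
noncomputable def bernsteinForm (d : ℕ) (x : Fin (d + 1) → ℝ) (a c : ℝ) : ℝ :=
  ∑ k : Fin (d + 1), x k * (d.choose k * a ^ (k : ℕ) * c ^ (d - k))

theorem bernsteinForm_mul (d : ℕ) (x : Fin (d + 1) → ℝ) (r a c : ℝ) :
    bernsteinForm d x (r * a) (r * c) = r ^ d * bernsteinForm d x a c := by
  rw [bernsteinForm, bernsteinForm, Finset.mul_sum]
  refine Finset.sum_congr rfl fun k _ => ?_
  have : r ^ d = r ^ (k : ℕ) * r ^ (d - k) := by
    rw [← pow_add, Nat.add_sub_cancel' (Nat.lt_succ_iff.1 k.2)]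
  rw [mul_pow, mul_pow, this]
  ring

theorem eval_bernsteinSum (d : ℕ) (x : Fin (d + 1) → ℝ) (z : ℝ) :
    (bernsteinSum d x).eval z = bernsteinForm d x z (1 - z) := by
  simp [bernsteinSum, bernsteinForm, Polynomial.eval_finsetSum, bernsteinPolynomial]

theorem sum_eq_bernsteinForm_one_right (d : ℕ) (x : Fin (d + 1) → ℝ) (t : ℝ) :
    ∑ k : Fin (d + 1), x k * (d.choose k * t ^ (k : ℕ)) = bernsteinForm d x t 1 := by
  simp [bernsteinForm]

theorem sum_eq_bernsteinForm_neg_one_right (d : ℕ) (x : Fin (d + 1) → ℝ) (t : ℝ) :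
    ∑ k : Fin (d + 1), (-1) ^ (k : ℕ) * x k * (d.choose k * t ^ (k : ℕ)) =
      bernsteinForm d x (-t) 1 := by
  simp only [bernsteinForm, one_pow, mul_one]
  refine Finset.sum_congr rfl fun k _ => ?_
  rw [neg_pow t]; ring

theorem sum_eq_bernsteinForm_one_left (d : ℕ) (x : Fin (d + 1) → ℝ) (t : ℝ) :
    ∑ k : Fin (d + 1), x k.rev * (d.choose k * t ^ (k : ℕ)) = bernsteinForm d x 1 t := by
  rw [← Equiv.sum_comp Fin.revPerm]
  simp only [bernsteinForm, one_pow, mul_one, Fin.revPerm_apply, Fin.rev_rev]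
  refine Finset.sum_congr rfl fun k _ => ?_
  have hk : (k : ℕ) ≤ d := Nat.lt_succ_iff.1 k.2
  rw [Fin.val_rev, show d + 1 - (k + 1 : ℕ) = d - k by omega, Nat.choose_symm hk]

theorem sum_eq_bernsteinForm_neg_one_left (d : ℕ) (x : Fin (d + 1) → ℝ) (t : ℝ) :
    ∑ k : Fin (d + 1), (-1) ^ (k : ℕ) * x k.rev * (d.choose k * t ^ (k : ℕ)) =
      bernsteinForm d x 1 (-t) := by
  rw [← sum_eq_bernsteinForm_one_left]
  refine Finset.sum_congr rfl fun k _ => ?_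
  rw [neg_pow t]; ring

theorem count_eq_encard {α : Type*} [MeasurableSpace α] [MeasurableSingletonClass α] (s : Set α) :
    Measure.count s = s.encard := by
  by_cases hs : s.Finite
  · exact Measure.count_apply hs.measurableSet
  · rw [Measure.count_apply_infinite hs, Set.Infinite.encard_eq hs]; rfl

theorem count_unitInterval_eq {P Q : ℝ → Prop} {I : Set ℝ} (φ h : ℝ → ℝ)
    (hφ : ∀ t ∈ Set.Ioo (0 : ℝ) 1, φ t ∈ I ∧ h (φ t) = t)
    (hh : ∀ z ∈ I, h z ∈ Set.Ioo (0 : ℝ) 1 ∧ φ (h z) = z)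
    (hPQ : ∀ t ∈ Set.Ioo (0 : ℝ) 1, P t ↔ Q (φ t)) :
    Measure.count (Set.Ioo (0 : ℝ) 1 ∩ {t | P t}) = Measure.count ({z | Q z} ∩ I) := by
  have himg : {z | Q z} ∩ I = φ '' (Set.Ioo (0 : ℝ) 1 ∩ {t | P t}) := by
    ext z
    constructor
    · rintro ⟨hz, hI⟩
      obtain ⟨h1, h2⟩ := hh z hI
      refine ⟨h z, ⟨h1, (hPQ _ h1).2 ?_⟩, h2⟩
      rw [h2]; exact hz
    · rintro ⟨t, ⟨ht, hP⟩, rfl⟩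
      exact ⟨(hPQ t ht).1 hP, (hφ t ht).1⟩
  have hinj : Set.InjOn φ (Set.Ioo (0 : ℝ) 1 ∩ {t | P t}) := fun a ha b hb hab => by
    rw [← (hφ a ha.1).2, hab, (hφ b hb.1).2]
  rw [himg, count_eq_encard, count_eq_encard, hinj.encard_image]

theorem bernsteinForm_mul_eq_zero_iff (d : ℕ) (x : Fin (d + 1) → ℝ) {r a c z : ℝ} (hr : r ≠ 0)
    (hz : z = r * a) (hz' : 1 - z = r * c) :
    bernsteinForm d x a c = 0 ↔ bernsteinForm d x z (1 - z) = 0 := by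
  rw [hz', hz, bernsteinForm_mul, mul_eq_zero, or_iff_right (pow_ne_zero d hr)]

/-- By homogeneity only the ratio z : (1 - z) matters. Here it is t : 1; the next three lemmas use
-t : 1, 1 : t and 1 : -t. -/
theorem unitIntervalZeros_eq (d : ℕ) (x : Fin (d + 1) → ℝ) :
    unitIntervalZeros d x =
      Measure.count ({z | bernsteinForm d x z (1 - z) = 0} ∩ Set.Ioo 0 (1 / 2)) := by
  simp only [unitIntervalZeros, sum_eq_bernsteinForm_one_right]
  refine count_unitInterval_eq (fun t => t / (1 + t)) (fun z => z / (1 - z)) ?_ ?_ ?_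
  · rintro t ⟨h0, h1⟩
    have h2 : 0 < 1 + t := by linarith
    refine ⟨⟨by positivity, ?_⟩, ?_⟩
    · rw [div_lt_div_iff₀ h2 two_pos]; linarith
    · field_simp; ring
  · rintro z ⟨h0, h1⟩
    have h2 : 0 < 1 - z := by linarith
    refine ⟨⟨by positivity, ?_⟩, ?_⟩
    · rw [div_lt_one h2]; linarith
    · field_simp; ring
  · rintro t ⟨h0, h1⟩
    have h2 : 0 < 1 + t := by linarith
    exact bernsteinForm_mul_eq_zero_iff d x (r := 1 / (1 + t)) (by positivity) (by ring)
      (by field_simp; ring)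

theorem unitIntervalZeros_neg_eq (d : ℕ) (x : Fin (d + 1) → ℝ) :
    unitIntervalZeros d (fun k => (-1) ^ (k : ℕ) * x k) =
      Measure.count ({z | bernsteinForm d x z (1 - z) = 0} ∩ Set.Iio 0) := by
  simp only [unitIntervalZeros, sum_eq_bernsteinForm_neg_one_right]
  refine count_unitInterval_eq (fun t => -t / (1 - t)) (fun z => -z / (1 - z)) ?_ ?_ ?_
  · rintro t ⟨h0, h1⟩
    have h2 : 0 < 1 - t := by linarith
    refine ⟨div_neg_of_neg_of_pos (by linarith) h2, ?_⟩
    field_simp; ring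
  · rintro z (h0 : z < 0)
    have h2 : 0 < 1 - z := by linarith
    refine ⟨⟨div_pos (by linarith) h2, ?_⟩, ?_⟩
    · rw [div_lt_one h2]; linarith
    · field_simp; ring
  · rintro t ⟨h0, h1⟩
    have h2 : 0 < 1 - t := by linarith
    exact bernsteinForm_mul_eq_zero_iff d x (r := 1 / (1 - t)) (by positivity) (by ring)
      (by field_simp; ring)

theorem unitIntervalZeros_rev_eq (d : ℕ) (x : Fin (d + 1) → ℝ) :
    unitIntervalZeros d (fun k => x k.rev) =
      Measure.count ({z | bernsteinForm d x z (1 - z) = 0} ∩ Set.Ioo (1 / 2) 1) := by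
  simp only [unitIntervalZeros, sum_eq_bernsteinForm_one_left]
  refine count_unitInterval_eq (fun t => 1 / (1 + t)) (fun z => (1 - z) / z) ?_ ?_ ?_
  · rintro t ⟨h0, h1⟩
    have h2 : 0 < 1 + t := by linarith
    refine ⟨⟨?_, ?_⟩, ?_⟩
    · rw [div_lt_div_iff₀ two_pos h2]; linarith
    · rw [div_lt_one h2]; linarith
    · field_simp; ring
  · rintro z ⟨h0, h1⟩
    have h2 : 0 < z := by linarith
    refine ⟨⟨div_pos (by linarith) h2, ?_⟩, ?_⟩
    · rw [div_lt_one h2]; linarith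
    · field_simp; ring
  · rintro t ⟨h0, h1⟩
    have h2 : 0 < 1 + t := by linarith
    exact bernsteinForm_mul_eq_zero_iff d x (r := 1 / (1 + t)) (by positivity) (by ring)
      (by field_simp; ring)

theorem unitIntervalZeros_neg_rev_eq (d : ℕ) (x : Fin (d + 1) → ℝ) :
    unitIntervalZeros d (fun k => (-1) ^ (k : ℕ) * x k.rev) =
      Measure.count ({z | bernsteinForm d x z (1 - z) = 0} ∩ Set.Ioi 1) := by
  simp only [unitIntervalZeros, sum_eq_bernsteinForm_neg_one_left]
  refine count_unitInterval_eq (fun t => 1 / (1 - t)) (fun z => (z - 1) / z) ?_ ?_ ?_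
  · rintro t ⟨h0, h1⟩
    have h2 : 0 < 1 - t := by linarith
    refine ⟨?_, ?_⟩
    · rw [Set.mem_Ioi, lt_div_iff₀ h2]; linarith
    · field_simp; ring
  · rintro z (h0 : 1 < z)
    have h2 : 0 < z := by linarith
    refine ⟨⟨div_pos (by linarith) h2, ?_⟩, ?_⟩
    · rw [div_lt_one h2]; linarith
    · field_simp; ring
  · rintro t ⟨h0, h1⟩
    have h2 : 0 < 1 - t := by linarith
    exact bernsteinForm_mul_eq_zero_iff d x (r := 1 / (1 - t)) (by positivity) (by ring)
      (by field_simp; ring)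

theorem count_zeros_bernsteinForm {d : ℕ} {x : Fin (d + 1) → ℝ} (hx : bernsteinSum d x ≠ 0) :
    Measure.count {z | bernsteinForm d x z (1 - z) = 0} = numRealRoots (bernsteinSum d x) := by
  have : {z | bernsteinForm d x z (1 - z) = 0} = ((bernsteinSum d x).roots.toFinset : Set ℝ) := by
    ext z
    simp [hx, ← eval_bernsteinSum]
  rw [this, Measure.count_apply_finset, numRealRoots]

/-- The four open intervals are disjoint and miss only 0, 1/2 and 1, hence the loss of at most 3. -/
theorem numRealRoots_bounds {d : ℕ} {x : Fin (d + 1) → ℝ} (hx : bernsteinSum d x ≠ 0) :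
    unitIntervalZeros d x + unitIntervalZeros d (fun k => (-1) ^ (k : ℕ) * x k) +
        unitIntervalZeros d (fun k => x k.rev) +
        unitIntervalZeros d (fun k => (-1) ^ (k : ℕ) * x k.rev) ≤
      numRealRoots (bernsteinSum d x) ∧
    (numRealRoots (bernsteinSum d x) : ENNReal) ≤
      unitIntervalZeros d x + unitIntervalZeros d (fun k => (-1) ^ (k : ℕ) * x k) +
        unitIntervalZeros d (fun k => x k.rev) +
        unitIntervalZeros d (fun k => (-1) ^ (k : ℕ) * x k.rev) + 3 := by
  rw [unitIntervalZeros_eq, unitIntervalZeros_neg_eq, unitIntervalZeros_rev_eq,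
    unitIntervalZeros_neg_rev_eq, ← count_zeros_bernsteinForm hx]
  set R := {z | bernsteinForm d x z (1 - z) = 0} with hR
  have hRf : R.Finite := by
    rw [← Measure.count_apply_lt_top, hR, count_zeros_bernsteinForm hx]
    exact ENNReal.natCast_lt_top _
  have hm : ∀ I, MeasurableSet (R ∩ I) := fun I => (hRf.subset Set.inter_subset_left).measurableSet
  constructor
  · rw [← measure_union _ (hm _), ← measure_union _ (hm _), ← measure_union _ (hm _)]
    · refine measure_mono ?_
      rintro z (((h | h) | h) | h) <;> exact h.1
    all_goals
      rw [Set.disjoint_left]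
      simp only [Set.mem_union, Set.mem_inter_iff, Set.mem_Ioo, Set.mem_Iio, Set.mem_Ioi]
      intro z h1 h2
      grind
  · have h3 : Measure.count (({0, 1 / 2, 1} : Finset ℝ) : Set ℝ) ≤ 3 := by
      rw [Measure.count_apply_finset]
      exact_mod_cast Finset.card_le_three
    have hsub : R ⊆ R ∩ Set.Ioo 0 (1 / 2) ∪ R ∩ Set.Iio 0 ∪ R ∩ Set.Ioo (1 / 2) 1 ∪ R ∩ Set.Ioi 1 ∪
        (({0, 1 / 2, 1} : Finset ℝ) : Set ℝ) := by
      intro z hz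
      simp only [Set.mem_union, Set.mem_inter_iff, hz, true_and, Set.mem_Ioo, Set.mem_Iio,
        Set.mem_Ioi, Finset.coe_insert, Finset.coe_singleton, Set.mem_insert_iff,
        Set.mem_singleton_iff]
      grind
    refine (measure_mono hsub).trans ?_
    refine (measure_union_le _ _).trans (add_le_add ?_ h3)
    refine (measure_union_le _ _).trans (add_le_add ?_ le_rfl)
    refine (measure_union_le _ _).trans (add_le_add ?_ le_rfl)
    exact measure_union_le _ _

/-- Dehomogenising, a vanishing Bernstein sum would force ∑ xₖ (d choose k) tᵏ to vanish for all t >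
0, hence coefficientwise. -/
theorem bernsteinSum_ne_zero {d : ℕ} {x : Fin (d + 1) → ℝ} (k : Fin (d + 1)) (hk : x k ≠ 0) :
    bernsteinSum d x ≠ 0 := by
  intro h
  set p : Polynomial ℝ := ∑ k : Fin (d + 1),
    Polynomial.C (x k * d.choose k) * Polynomial.X ^ (k : ℕ) with hp
  have hp0 : p = 0 := by
    refine Polynomial.eq_zero_of_infinite_isRoot p ((Set.Ioi_infinite (0 : ℝ)).mono ?_)
    intro t (ht : 0 < t)
    have h1 : p.eval t = bernsteinForm d x t 1 := by
      rw [← sum_eq_bernsteinForm_one_right]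
      simp [hp, Polynomial.eval_finsetSum, mul_assoc]
    rw [Set.mem_ofPred_eq, Polynomial.IsRoot, h1,
      bernsteinForm_mul_eq_zero_iff d x (r := 1 / (1 + t)) (z := t / (1 + t)) (by positivity)
        (by ring) (by field_simp; ring), ← eval_bernsteinSum, h, Polynomial.eval_zero]
  have hcoeff : p.coeff k = x k * d.choose k := by
    simp only [hp, Polynomial.finsetSum_coeff, Polynomial.coeff_C_mul_X_pow, Fin.val_inj]
    simp
  rw [hp0, Polynomial.coeff_zero] at hcoeff
  have hch : (0 : ℝ) < d.choose k := by
    exact_mod_cast Nat.choose_pos (Nat.lt_succ_iff.1 k.2)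
  exact mul_ne_zero hk hch.ne' hcoeff.symm

/-! ### Assembly -/

theorem mainTheorem3 (v₀ v₁ : ℝ≥0) :
    ∃ C : ℝ, ∀ (d : ℕ), 2 ≤ d →
      ∀ {Ω : Type*} [MeasurableSpace Ω] (μ : Measure Ω) [IsProbabilityMeasure μ]
        (b : Fin (d + 1) → Ω → ℝ),
        iIndepFun b μ →
        (∀ k : Fin (d + 1), HasLaw (b k) (gaussianReal 0 (coeffVariance v₀ v₁ d (k : ℕ))) μ) →
        (∀ᵐ ω ∂μ, bernsteinSum d (fun k => b k ω) ≠ 0) ∧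
        Integrable (fun ω => (numRealRoots (bernsteinSum d (fun k => b k ω)) : ℝ)) μ ∧
        |∫ ω, (numRealRoots (bernsteinSum d (fun k => b k ω)) : ℝ) ∂μ - √(2 * (d : ℝ))| ≤ C := by
  obtain ⟨C₁, h₁⟩ := exists_lintegral_unitIntervalZeros v₀ v₁
  obtain ⟨C₂, h₂⟩ := exists_lintegral_unitIntervalZeros v₁ v₀
  -- Two charts keep the order of the coefficients (C₁), two reverse it and swap v₀ with v₁ (C₂); 3
  -- pays for the exceptional points.
  refine ⟨2 * C₁ + 2 * C₂ + 3, fun d hd {Ω} _ μ _ b hb hl => ?_⟩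
  obtain ⟨r₁, hr₁, hC₁, hi₁⟩ := h₁ d hd
  obtain ⟨r₂, hr₂, hC₂, hi₂⟩ := h₂ d hd
  have hbm : AEMeasurable (fun ω k => b k ω) μ :=
    aemeasurable_pi_lambda _ fun k => (hl k).aemeasurable
  have hrb : iIndepFun (fun k : Fin (d + 1) => b k.rev) μ := hb.precomp Fin.rev_injective
  have hrl : ∀ k : Fin (d + 1),
      HasLaw (b k.rev) (gaussianReal 0 (coeffVariance v₁ v₀ d (k : ℕ))) μ := fun k => by
    have := hl k.rev
    rwa [Fin.val_rev, show d + 1 - ((k : ℕ) + 1) = d - k by omega,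
      coeffVariance_sub v₀ v₁ hd (Nat.lt_succ_iff.1 k.2)] at this
  -- Since 0 < 1 < d, the coefficient of index 1 has positive variance and is almost surely nonzero.
  have hne : ∀ᵐ ω ∂μ, bernsteinSum d (fun k => b k ω) ≠ 0 := by
    have h1d : 1 < d + 1 := by omega
    have hv := (coeffVariance_pos v₀ v₁ one_pos (by omega : 1 < d)).ne'
    have : ∀ᵐ y ∂(gaussianReal 0 (coeffVariance v₀ v₁ d 1)), y ≠ 0 := by
      have := nullSingletonClass_gaussianReal (μ := 0) hv
      exact Measure.ae_ne _ _
    have h2 := hl ⟨1, h1d⟩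
    rw [← h2.map_eq] at this
    filter_upwards [ae_of_ae_map h2.aemeasurable this] with ω hω
    exact bernsteinSum_ne_zero ⟨1, h1d⟩ hω
  set N : Ω → ℝ := fun ω => (numRealRoots (bernsteinSum d (fun k => b k ω)) : ℝ) with hN
  have hNm : AEStronglyMeasurable N μ := by
    have hcm : Measurable fun x : Fin (d + 1) → ℝ =>
        Measure.count (Set.univ ∩ {z | bernsteinForm d x z (1 - z) = 0}) :=
      measurable_count_section (Z := {p : (Fin (d + 1) → ℝ) × ℝ |
        bernsteinForm d p.1 p.2 (1 - p.2) = 0})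
        (isClosed_eq (by unfold bernsteinForm; fun_prop) continuous_const) isOpen_univ
    refine ((hcm.comp_aemeasurable hbm).ennreal_toReal.congr ?_).aestronglyMeasurable
    filter_upwards [hne] with ω hω
    simp only [Function.comp_apply, Set.univ_inter, hN, count_zeros_bernsteinForm hω,
      ENNReal.toReal_natCast]
  have hNnn : 0 ≤ᵐ[μ] N := .of_forall fun ω => Nat.cast_nonneg _
  have hofN : ∀ ω, ENNReal.ofReal (N ω) = numRealRoots (bernsteinSum d (fun k => b k ω)) :=
    fun ω => ENNReal.ofReal_natCast _
  have m : ∀ f : (Fin (d + 1) → ℝ) → (Fin (d + 1) → ℝ), Measurable f →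
      AEMeasurable (fun ω => unitIntervalZeros d (f fun k => b k ω)) μ := fun f hf =>
    (measurable_unitIntervalZeros d).comp_aemeasurable (hf.comp_aemeasurable hbm)
  have m2 := m (fun x k => (-1) ^ (k : ℕ) * x k) (by fun_prop)
  have m3 := m (fun x k => x k.rev) (by fun_prop)
  have m4 := m (fun x k => (-1) ^ (k : ℕ) * x k.rev) (by fun_prop)
  have hsum : ∫⁻ ω, (unitIntervalZeros d (fun k => b k ω) +
      unitIntervalZeros d (fun k => (-1) ^ (k : ℕ) * b k ω) +
      unitIntervalZeros d (fun k => b k.rev ω) +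
      unitIntervalZeros d (fun k => (-1) ^ (k : ℕ) * b k.rev ω)) ∂μ =
      ENNReal.ofReal (2 * r₁ + 2 * r₂) := by
    rw [lintegral_add_right' _ m4, lintegral_add_right' _ m3, lintegral_add_right' _ m2,
      hi₁ μ b hb hl, hi₁ μ _ (iIndepFun_neg_one_pow_mul hb) (hasLaw_neg_one_pow_mul hl),
      hi₂ μ _ hrb hrl, hi₂ μ _ (iIndepFun_neg_one_pow_mul hrb) (hasLaw_neg_one_pow_mul hrl),
      ← ENNReal.ofReal_add hr₁ hr₁, ← ENNReal.ofReal_add (by positivity) hr₂,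
      ← ENNReal.ofReal_add (by positivity) hr₂]
    congr 1
    ring
  have hlow : ENNReal.ofReal (2 * r₁ + 2 * r₂) ≤ ∫⁻ ω, ENNReal.ofReal (N ω) ∂μ := by
    rw [← hsum]
    refine lintegral_mono_ae ?_
    filter_upwards [hne] with ω hω
    rw [hofN]
    exact (numRealRoots_bounds hω).1
  have hup : ∫⁻ ω, ENNReal.ofReal (N ω) ∂μ ≤ ENNReal.ofReal (2 * r₁ + 2 * r₂ + 3) := by
    calc ∫⁻ ω, ENNReal.ofReal (N ω) ∂μ ≤ ∫⁻ ω, (unitIntervalZeros d (fun k => b k ω) +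
          unitIntervalZeros d (fun k => (-1) ^ (k : ℕ) * b k ω) +
          unitIntervalZeros d (fun k => b k.rev ω) +
          unitIntervalZeros d (fun k => (-1) ^ (k : ℕ) * b k.rev ω) + 3) ∂μ := by
          refine lintegral_mono_ae ?_
          filter_upwards [hne] with ω hω
          rw [hofN]
          exact (numRealRoots_bounds hω).2
      _ = _ := by
          rw [lintegral_add_right _ measurable_const, hsum, lintegral_const, measure_univ, mul_one,
            ENNReal.ofReal_add (p := 2 * r₁ + 2 * r₂) (q := 3) (by positivity) (by norm_num)]
          simp
  have hNi : Integrable N μ := by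
    refine ⟨hNm, ?_⟩
    rw [hasFiniteIntegral_iff_ofReal hNnn]
    exact hup.trans_lt ENNReal.ofReal_lt_top
  refine ⟨hne, hNi, ?_⟩
  have hint : 0 ≤ ∫ ω, N ω ∂μ := integral_nonneg_of_ae hNnn
  rw [← ofReal_integral_eq_lintegral_ofReal hNi hNnn] at hlow hup
  have hlow' := (ENNReal.ofReal_le_ofReal_iff hint).1 hlow
  have hup' := (ENNReal.ofReal_le_ofReal_iff (by positivity)).1 hup
  rw [abs_le] at hC₁ hC₂ ⊢
  constructor <;> linarith [hC₁.1, hC₁.2, hC₂.1, hC₂.2]
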